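/- Let $\mathbb T=\mathbb R/\mathbb Z$, let $\omega\in\mathbb R\setminus\mathbb Q$ and $\tau,\alpha,\beta\in\mathbb R$, and let $f:\mathbb T\times\mathbb T\to\mathbb T\times\mathbb T$ be the quasiperiodically forced Arnold map $$f(\theta,\varphi)=\Bigl(\theta+\omega,\ \varphi+\tau+\tfrac{\alpha}{2\pi}\sin(2\pi\varphi)+\beta\sin(2\pi\theta)\bmod 1\Bigr).$$ Let $\pi:\mathbb T\times\mathbb R\to\mathbb T\times\mathbb T$ be the natural projection, let $F:\mathbb T\times\mathbb R\to\mathbb T\times\mathbb R$ be any continuous lift of $f$ (that is, $\pi\circ F=f\circ\pi$), and write $F^n(\theta,x)=(\theta+n\omega,F^n_\theta(x))$. The fibred rotation interval is $$\rho_{\mathrm{fib}}(F)=\Bigl\{\limsup_{n\to\infty}\tfrac1n\bigl(F^n_\theta(x)-x\bigr)\ :\ (\theta,x)\in\mathbb T\times\mathbb R\Bigr\}.$$ A minimal set of $f$ is a non-empty closed set $M$ with $f(M)\subseteq M$ that has no proper non-empty closed subset $N$ with $f(N)\subseteq N$. A compact set $M\subseteq\mathbb T\times\mathbb T$ is a strangely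 dispersed minimal set if it is a minimal set of $f$, every connected component of $M$ projects to a single point under the projection $\pi_1$ to the first coordinate, and for every $z\in M$ and every open neighbourhood $U$ of $z$ the set $\pi_1(U\cap M)$ contains a non-empty open interval. (a) If $\alpha>1$ and $|\beta|\ge\frac32$, then for every $\rho\in\rho_{\mathrm{fib}}(F)$ there is a strangely dispersed minimal set $M_\rho$ such that (i) $\frac1n(F^n_\theta(x)-x)$ converges to $\rho$ uniformly on $\pi^{-1}(M_\rho)$ as $n\to\infty$, and (ii) the topological entropy of $f|_{M_\rho}$ is $0$. (b) If $|\alpha|\ge\frac52\pi$, then $\rho_{\mathrm{fib}}(F)$ is a compact interval of length at least $1$; in particular its interior is non-empty. (c) If the conditions of (a) and (b) both hold, then the sets $M_\rho$, $\rho\in\rho_{\mathrm{fib}}(F)$, in (a) can be chosen pairwise disjoint, and they form an uncountable family of strangely dispersed minimal sets. -/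

import Mathlib

open Set Filter Topology

namespace QPF

noncomputable section

/-- The circle `𝕋 = ℝ/ℤ`. -/
abbrev Circ : Type := UnitAddCircle

/-- The natural projection `𝕋 × ℝ → 𝕋 × 𝕋`. -/
def proj (z : Circ × ℝ) : Circ × Circ := (z.1, (z.2 : Circ))

theorem sin_two_pi_periodic :
    Function.Periodic (fun x : ℝ => Real.sin (2 * Real.pi * x)) 1 := by
  intro x
  simp only [mul_add, mul_one, Real.sin_add_two_pi]

/-- The function `x ↦ sin (2πx)` on the circle `ℝ/ℤ`. -/
def sinCirc (x : Circ) : ℝ := sin_two_pi_periodic.lift x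

/-- The quasiperiodically forced Arnold circle map
`f(θ, φ) = (θ + ω, φ + τ + α/(2π) sin(2πφ) + β sin(2πθ) mod 1)`. -/
def arnold (ω τ α β : ℝ) (z : Circ × Circ) : Circ × Circ :=
  (z.1 + (ω : Circ),
    z.2 + ((τ + α / (2 * Real.pi) * sinCirc z.2 + β * sinCirc z.1 : ℝ) : Circ))

/-- `F : 𝕋 × ℝ → 𝕋 × ℝ` is a (continuous) lift of `f : 𝕋 × 𝕋 → 𝕋 × 𝕋`. -/
structure IsLift (f : Circ × Circ → Circ × Circ) (F : Circ × ℝ → Circ × ℝ) : Prop where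
  continuous : Continuous F
  semiconj : ∀ z, proj (F z) = f (proj z)

/-- The standard lift of the forced Arnold map. -/
def arnoldLift (ω τ α β : ℝ) (z : Circ × ℝ) : Circ × ℝ :=
  (z.1 + (ω : Circ),
    z.2 + τ + α / (2 * Real.pi) * Real.sin (2 * Real.pi * z.2) + β * sinCirc z.1)

theorem continuous_sinCirc : Continuous sinCirc :=
  Continuous.quotient_lift (s := QuotientAddGroup.leftRel (AddSubgroup.zmultiples (1 : ℝ)))
    (f := fun x : ℝ => Real.sin (2 * Real.pi * x)) (by fun_prop) _

/-- Lifts of the forced Arnold map exist. -/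
theorem isLift_arnoldLift (ω τ α β : ℝ) :
    IsLift (arnold ω τ α β) (arnoldLift ω τ α β) where
  continuous := by
    have := continuous_sinCirc
    unfold arnoldLift
    fun_prop
  semiconj z := by
    have h : sinCirc (z.2 : Circ) = Real.sin (2 * Real.pi * z.2) := rfl
    simp only [proj, arnold, arnoldLift, h]
    congr 1
    rw [← AddCircle.coe_add]
    congr 1
    ring

/-- The average displacement `(F^n_θ(x) - x) / n` in the fibre, at `z = (θ, x)`. -/
def avgDisp (F : Circ × ℝ → Circ × ℝ) (n : ℕ) (z : Circ × ℝ) : ℝ :=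
  ((F^[n] z).2 - z.2) / n

/-- The fibred rotation interval of a lift `F`: the set of all upper limits of
`(F^n_θ(x) - x) / n`. (For lifts of maps homotopic to the identity these sequences are bounded,
so that the real-valued `limsup` is the usual one.) -/
def fibRot (F : Circ × ℝ → Circ × ℝ) : Set ℝ :=
  {ρ | ∃ z : Circ × ℝ, ρ = limsup (fun n : ℕ => avgDisp F n z) atTop}

/-- `M` is a minimal set of `f`: non-empty, closed, `f`-invariant, with no proper non-empty closed
`f`-invariant subset. -/
structure IsMinimalSet {X : Type*} [TopologicalSpace X] (f : X → X) (M : Set X) : Prop where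
  nonempty : M.Nonempty
  isClosed : IsClosed M
  mapsTo : MapsTo f M M
  eq_of_subset : ∀ N ⊆ M, N.Nonempty → IsClosed N → MapsTo f N N → N = M

/-- Strangely dispersed minimal sets. -/
structure IsStrangelyDispersed (f : Circ × Circ → Circ × Circ) (M : Set (Circ × Circ)) :
    Prop where
  isCompact : IsCompact M
  minimal : IsMinimalSet f M
  /-- Every connected component of `M` lies in a single fibre. -/
  component : ∀ z ∈ M, ∃ θ : Circ, Prod.fst '' connectedComponentIn M z = {θ}
  /-- Every relatively open non-empty piece of `M` projects onto a set containing a non-empty open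
  interval of the circle. -/
  dispersed : ∀ z ∈ M, ∀ U : Set (Circ × Circ), IsOpen U → z ∈ U →
    ∃ a b : ℝ, a < b ∧ (fun t : ℝ => (t : Circ)) '' Ioo a b ⊆ Prod.fst '' (U ∩ M)

/-- `(F^n_θ(x) - x) / n` converges to `ρ` uniformly on `π⁻¹(M)`. -/
def HasUniformRotation (F : Circ × ℝ → Circ × ℝ) (M : Set (Circ × Circ)) (ρ : ℝ) : Prop :=
  TendstoUniformlyOn (avgDisp F) (fun _ => ρ) atTop (proj ⁻¹' M)

/-- `h_top(f|_M) = 0`: the restriction of `f` to the `f`-invariant set `M` has zero topological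
entropy. -/
def ZeroEntropyOn (f : Circ × Circ → Circ × Circ) (M : Set (Circ × Circ)) : Prop :=
  ∃ h : MapsTo f M M, Dynamics.coverEntropy (h.restrict f M M) univ = 0

end

end QPF

/-! The running infimum and supremum of the fibre map `G` are joined by a path of monotone maps
`g`, each equal to `G` away from the open set where `g` is locally constant. Monotone skew products
have a rotation number, depending continuously on `g`, so every number between the two extreme ones
is attained. By compactness some orbits of the monotone system never meet a plateau; they are
orbits of the original system too, and a minimal set among them inherits the rotation number and,
by monotonicity, has zero entropy. On a connected subset of it, which avoids a circle `𝕋 × {v}`, the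
fibre coordinate has oscillation less than one, and the same holds for its image; hence it cannot
project onto the whole circle when the forcing oscillates by at least two. The base coordinate then
lifts to `ℝ` on the minimal set, and minimality makes this lift constant on each component. -/

namespace QuasiperiodicForcing

open QPF

noncomputable section

/-- `H : ℝ → ℝ` is a lift of a continuous circle map of degree one. -/
structure IsDegOneLift (H : ℝ → ℝ) : Prop where
  continuous : Continuous H
  map_add_one : ∀ x, H (x + 1) = H x + 1

/-- `g : ℝ → ℝ` is a lift of a continuous, weakly order preserving circle map of degree one. -/
structure IsMonoLift (g : ℝ → ℝ) : Prop extends IsDegOneLift g where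
  monotone : Monotone g

/-- The skew product `(θ, x) ↦ (θ + ω, g x + b θ)` over the rotation by `ω`. The lifts
of the forced Arnold map are of this form. -/
def skew (ω : Circ) (b : Circ → ℝ) (g : ℝ → ℝ) (z : Circ × ℝ) : Circ × ℝ :=
  (z.1 + ω, g z.2 + b z.1)

/-- The total displacement `F^n_θ(x) - x` in the fibre, at `z = (θ, x)`. -/
def disp (F : Circ × ℝ → Circ × ℝ) (n : ℕ) (z : Circ × ℝ) : ℝ := (F^[n] z).2 - z.2

theorem IsDegOneLift.map_add_int {H : ℝ → ℝ} (hH : IsDegOneLift H) (x : ℝ) (k : ℤ) :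
    H (x + k) = H x + k := by
  simpa using AddConstMapClass.map_add_int (⟨H, hH.map_add_one⟩ : AddConstMap ℝ ℝ 1 1) x k

theorem IsDegOneLift.periodic_sub_id {H : ℝ → ℝ} (hH : IsDegOneLift H) :
    Function.Periodic (fun x => H x - x) 1 := fun x => by
  simp only [hH.map_add_one, add_sub_add_right_eq_sub]

theorem IsDegOneLift.exists_abs_sub_le {H : ℝ → ℝ} (hH : IsDegOneLift H) :
    ∃ C, ∀ x, |H x - x| ≤ C := by
  obtain ⟨C, hC⟩ := (hH.periodic_sub_id.compact_of_continuous one_ne_zero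
    (hH.continuous.sub continuous_id)).isBounded.exists_norm_le
  exact ⟨C, fun x => hC _ (mem_range_self x)⟩

theorem IsMonoLift.abs_sub_id_sub_sub_id_le {g : ℝ → ℝ} (hg : IsMonoLift g) (x y : ℝ) :
    |(g x - x) - (g y - y)| ≤ 1 := by
  have hlow : g x ≤ g (y + ⌈x - y⌉) := hg.monotone (by linarith [Int.le_ceil (x - y)])
  have hupp : g (y + ⌊x - y⌋) ≤ g x := hg.monotone (by linarith [Int.floor_le (x - y)])
  rw [hg.map_add_int] at hlow hupp
  rw [abs_le]
  constructor <;> linarith [Int.ceil_lt_add_one (x - y), Int.lt_floor_add_one (x - y)]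

section Displacement

variable {F : Circ × ℝ → Circ × ℝ} {C : ℝ}

theorem avgDisp_eq (F : Circ × ℝ → Circ × ℝ) (n : ℕ) (z : Circ × ℝ) :
    avgDisp F n z = disp F n z / n := rfl

theorem disp_add (F : Circ × ℝ → Circ × ℝ) (m n : ℕ) (z : Circ × ℝ) :
    disp F (m + n) z = disp F m z + disp F n (F^[m] z) := by
  simp only [disp, add_comm m n, Function.iterate_add_apply]
  ring

theorem abs_disp_mul_sub_le {N : ℕ} {c ε : ℝ} (h : ∀ z, |disp F N z - c| ≤ ε) (k : ℕ)
    (z : Circ × ℝ) : |disp F (k * N) z - k * c| ≤ k * ε := by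
  induction k with
  | zero => simp [disp]
  | succ k ih =>
    rw [add_mul, one_mul, disp_add]
    have hstep := h (F^[k * N] z)
    push_cast
    rw [abs_le] at ih hstep ⊢
    constructor <;> linarith

theorem abs_disp_le (hC : ∀ z, |disp F 1 z| ≤ C) (n : ℕ) (z : Circ × ℝ) :
    |disp F n z| ≤ n * C := by
  have hC' (w : Circ × ℝ) : |disp F 1 w - 0| ≤ C := by simpa only [sub_zero] using hC w
  simpa only [mul_one, mul_zero, sub_zero] using abs_disp_mul_sub_le hC' n z

theorem abs_disp_iterate_sub_le (hC : ∀ z, |disp F 1 z| ≤ C) (n j : ℕ) (z : Circ × ℝ) :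
    |disp F n (F^[j] z) - disp F n z| ≤ 2 * (j * C) := by
  have hswap := disp_add F j n z
  rw [add_comm, disp_add] at hswap
  have hz := abs_le.1 (abs_disp_le hC j z)
  have hFz := abs_le.1 (abs_disp_le hC j (F^[n] z))
  rw [abs_le]
  constructor <;> linarith [hz.1, hz.2, hFz.1, hFz.2]

theorem abs_sub_le_of_tendsto_avgDisp {z : Circ × ℝ} {ρ c ε : ℝ} {N : ℕ} (hN : 0 < N)
    (hρ : Tendsto (fun n => avgDisp F n z) atTop (𝓝 ρ))
    (h : ∀ w, |avgDisp F N w - c| ≤ ε) : |ρ - c| ≤ ε := by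
  have hN' : (0 : ℝ) < N := Nat.cast_pos.2 hN
  have hdisp (w : Circ × ℝ) : |disp F N w - N * c| ≤ N * ε := by
    have hw := h w
    rw [avgDisp_eq, div_sub' hN'.ne', abs_div, Nat.abs_cast, div_le_iff₀ hN'] at hw
    linarith
  have hmul : Tendsto (fun k : ℕ => k * N) atTop atTop := tendsto_id.atTop_mul_const' hN
  refine le_of_tendsto ((hρ.comp hmul).sub_const c).abs ?_
  filter_upwards [eventually_gt_atTop 0] with k hk
  have hkN : (0 : ℝ) < (k * N : ℕ) := Nat.cast_pos.2 (mul_pos hk hN)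
  rw [Function.comp_apply, avgDisp_eq, div_sub' hkN.ne', abs_div, Nat.abs_cast, div_le_iff₀ hkN]
  have hkz := abs_disp_mul_sub_le hdisp k z
  rw [Nat.cast_mul, mul_assoc]
  linarith

end Displacement

section Skew

variable {ω : Circ} {b : Circ → ℝ} {g G : ℝ → ℝ}

theorem iterate_skew_fst (n : ℕ) (z : Circ × ℝ) : ((skew ω b g)^[n] z).1 = z.1 + n • ω := by
  induction n with
  | zero => simp
  | succ n ih => rw [Function.iterate_succ_apply', skew, ih, succ_nsmul, add_assoc]

theorem iterate_succ_skew_snd (n : ℕ) (z : Circ × ℝ) :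
    ((skew ω b g)^[n + 1] z).2 = g ((skew ω b g)^[n] z).2 + b (z.1 + n • ω) := by
  rw [Function.iterate_succ_apply', skew, iterate_skew_fst]

theorem IsDegOneLift.iterate_skew (hg : IsDegOneLift g) (n : ℕ) (θ : Circ) :
    IsDegOneLift fun x => ((skew ω b g)^[n] (θ, x)).2 := by
  induction n with
  | zero => exact ⟨continuous_id, fun _ => rfl⟩
  | succ n ih =>
    simp only [iterate_succ_skew_snd]
    refine ⟨(hg.continuous.comp ih.continuous).add continuous_const, fun x => ?_⟩
    rw [ih.map_add_one, hg.map_add_one]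
    ring

theorem IsMonoLift.iterate_skew (hg : IsMonoLift g) (n : ℕ) (θ : Circ) :
    IsMonoLift fun x => ((skew ω b g)^[n] (θ, x)).2 where
  toIsDegOneLift := hg.toIsDegOneLift.iterate_skew n θ
  monotone := by
    induction n with
    | zero => exact monotone_id
    | succ n ih =>
      simp only [iterate_succ_skew_snd]
      exact (hg.monotone.comp ih).add_const _

theorem IsMonoLift.abs_disp_sub_disp_le (hg : IsMonoLift g) (n : ℕ) (θ : Circ) (x y : ℝ) :
    |disp (skew ω b g) n (θ, x) - disp (skew ω b g) n (θ, y)| ≤ 1 :=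
  (hg.iterate_skew n θ).abs_sub_id_sub_sub_id_le x y

theorem IsDegOneLift.exists_abs_disp_le (hg : IsDegOneLift g) (hb : Continuous b) :
    ∃ C, ∀ z, |disp (skew ω b g) 1 z| ≤ C := by
  obtain ⟨B, hB⟩ := isCompact_univ.exists_bound_of_continuousOn hb.continuousOn
  obtain ⟨C, hC⟩ := hg.exists_abs_sub_le
  refine ⟨C + B, fun z => ?_⟩
  have hdisp : disp (skew ω b g) 1 z = (g z.2 - z.2) + b z.1 := add_sub_right_comm _ _ _
  rw [hdisp]
  exact (abs_add_le _ _).trans (add_le_add (hC _) (hB _ (mem_univ _)))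

theorem iterate_skew_snd_le_iterate_skew_snd (hmono : Monotone g ∨ Monotone G) (h : g ≤ G)
    (n : ℕ) (z : Circ × ℝ) : ((skew ω b g)^[n] z).2 ≤ ((skew ω b G)^[n] z).2 := by
  induction n with
  | zero => exact le_rfl
  | succ n ih =>
    rw [iterate_succ_skew_snd, iterate_succ_skew_snd]
    gcongr
    rcases hmono with hg | hG
    · exact (hg ih).trans (h _)
    · exact (h _).trans (hG ih)

theorem avgDisp_skew_le_avgDisp_skew (hmono : Monotone g ∨ Monotone G) (h : g ≤ G) (n : ℕ)
    (z : Circ × ℝ) : avgDisp (skew ω b g) n z ≤ avgDisp (skew ω b G) n z := by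
  unfold avgDisp
  gcongr
  exact iterate_skew_snd_le_iterate_skew_snd hmono h n z

theorem continuous_iterate_skew {P : Type*} [TopologicalSpace P] {g : P → ℝ → ℝ}
    (hb : Continuous b) (hg : Continuous fun p : P × ℝ => g p.1 p.2) (n : ℕ) :
    Continuous fun p : P × (Circ × ℝ) => (skew ω b (g p.1))^[n] p.2 := by
  induction n with
  | zero => exact continuous_snd
  | succ n ih =>
    simp only [Function.iterate_succ_apply', skew]
    have hfib := hg.comp (continuous_fst.prodMk (continuous_snd.comp ih))
    exact (by fun_prop : Continuous _).prodMk (hfib.add (by fun_prop))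

theorem continuous_skew (hb : Continuous b) (hg : Continuous g) : Continuous (skew ω b g) := by
  unfold skew
  fun_prop

end Skew

theorem le_iSup_of_forall_abs_le {X : Type*} {a : X → ℝ} {B : ℝ} (hB : ∀ x, |a x| ≤ B) (x : X) :
    a x ≤ ⨆ y, a y :=
  le_ciSup ⟨B, forall_mem_range.2 fun y => (abs_le.1 (hB y)).2⟩ x

theorem exists_tendsto_iSup_div {X : Type*} [Nonempty X] {T : X → X} {a : ℕ → X → ℝ} {C : ℝ}
    (hadd : ∀ m n x, a (m + n) x = a m x + a n (T^[m] x)) (hC : ∀ n x, |a n x| ≤ n * C) :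
    ∃ L, Tendsto (fun n : ℕ => (⨆ x, a n x) / n) atTop (𝓝 L) := by
  have hsub : Subadditive fun n => ⨆ x, a n x := fun m n => ciSup_le fun x => by
    rw [hadd]
    exact add_le_add (le_iSup_of_forall_abs_le (hC m) x) (le_iSup_of_forall_abs_le (hC n) _)
  refine ⟨hsub.lim, hsub.tendsto_lim ⟨-|C|, forall_mem_range.2 fun n => ?_⟩⟩
  obtain ⟨x⟩ := ‹Nonempty X›
  rcases n.eq_zero_or_pos with rfl | hn
  · simp
  · have hpos : (0 : ℝ) < n := Nat.cast_pos.2 hn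
    rw [le_div_iff₀ hpos]
    linarith [(abs_le.1 (hC n x)).1, le_iSup_of_forall_abs_le (hC n) x,
      mul_le_mul_of_nonneg_left (le_abs_self C) hpos.le]

theorem le_div_of_tendsto_div {a : ℕ → ℝ} {L c K : ℝ} {N : ℕ} (hN : 0 < N)
    (hL : Tendsto (fun n => a n / n) atTop (𝓝 L)) (ha : ∀ k : ℕ, a (k * N) ≤ c * k + K) :
    L ≤ c / N := by
  have hmul : Tendsto (fun k : ℕ => k * N) atTop atTop := tendsto_id.atTop_mul_const' hN
  have hK : Tendsto (fun k : ℕ => c / N + K / (k * N : ℕ)) atTop (𝓝 (c / N + 0)) :=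
    tendsto_const_nhds.add ((tendsto_const_div_atTop_nhds_zero_nat K).comp hmul)
  rw [add_zero] at hK
  refine le_of_tendsto_of_tendsto (hL.comp hmul) hK ?_
  filter_upwards [eventually_gt_atTop 0] with k hk
  calc a (k * N) / (k * N : ℕ) ≤ (c * k + K) / (k * N : ℕ) := by gcongr; exact ha k
    _ = c / N + K / (k * N : ℕ) := by
      have : (k : ℝ) ≠ 0 := Nat.cast_ne_zero.2 hk.ne'
      push_cast
      field_simp

theorem exists_le_forall_exists_dist_add_nsmul_lt {ω : Circ}
    (hω : DenseRange fun n : ℕ => n • ω) {δ : ℝ} (hδ : 0 < δ) :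
    ∃ J : ℕ, ∀ θ θ' : Circ, ∃ j ≤ J, dist (θ + j • ω) θ' < δ := by
  have hcover : (univ : Set Circ) ⊆ ⋃ j : ℕ, Metric.ball (j • ω) δ := fun t _ =>
    mem_iUnion.2 (hω.exists_dist_lt t hδ)
  obtain ⟨s, hs⟩ := isCompact_univ.elim_finite_subcover _ (fun _ => Metric.isOpen_ball) hcover
  refine ⟨s.sup id, fun θ θ' => ?_⟩
  obtain ⟨j, hj, hdist⟩ := mem_iUnion₂.1 (hs (mem_univ (θ' - θ)))
  refine ⟨j, Finset.le_sup (f := id) hj, ?_⟩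
  rw [Metric.mem_ball, dist_comm] at hdist
  rwa [← dist_add_left θ, add_sub_cancel] at hdist

/-- The fibred rotation number of `F`, the common limit of the averages `(F^n_θ(x) - x) / n`,
evaluated at the origin; it is a junk value when that limit does not exist. -/
def fibRotNum (F : Circ × ℝ → Circ × ℝ) : ℝ := limUnder atTop fun n => avgDisp F n 0

section Rotation

variable {ω : Circ} {b : Circ → ℝ} {g : ℝ → ℝ}

theorem IsMonoLift.abs_disp_mul_sub_disp_mul_le (hg : IsMonoLift g) {N : ℕ} {δ : ℝ}
    (hδ : ∀ θ θ' : Circ, dist θ θ' < δ →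
      |disp (skew ω b g) N (θ, 0) - disp (skew ω b g) N (θ', 0)| ≤ 1)
    (k : ℕ) {z z' : Circ × ℝ} (hz : dist z.1 z'.1 < δ) :
    |disp (skew ω b g) (k * N) z - disp (skew ω b g) (k * N) z'| ≤ 3 * k := by
  induction k with
  | zero => simp [disp]
  | succ k ih =>
    rw [add_mul, one_mul, disp_add, disp_add]
    set w := (skew ω b g)^[k * N] z with hw
    set w' := (skew ω b g)^[k * N] z' with hw'
    have hdist : dist w.1 w'.1 < δ := by
      rwa [hw, hw', iterate_skew_fst, iterate_skew_fst, dist_add_right]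
    have hbase := abs_le.1 (hδ _ _ hdist)
    have hfib := abs_le.1 (hg.abs_disp_sub_disp_le (ω := ω) (b := b) N w.1 w.2 0)
    have hfib' := abs_le.1 (hg.abs_disp_sub_disp_le (ω := ω) (b := b) N w'.1 w'.2 0)
    rw [Prod.mk.eta] at hfib hfib'
    rw [abs_le] at ih ⊢
    push_cast
    constructor <;> linarith [hbase.1, hbase.2, hfib.1, hfib.2, hfib'.1, hfib'.2]

/-- The denseness of the orbits of the rotation brings two arbitrary points into nearby fibres
within a bounded time, at a bounded cost. -/
theorem IsMonoLift.exists_disp_mul_sub_disp_mul_le (hg : IsMonoLift g) (hb : Continuous b)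
    (hω : DenseRange fun n : ℕ => n • ω) (N : ℕ) :
    ∃ K, ∀ (k : ℕ) (z z' : Circ × ℝ),
      disp (skew ω b g) (k * N) z - disp (skew ω b g) (k * N) z' ≤ 3 * k + K := by
  obtain ⟨C, hC⟩ := hg.exists_abs_disp_le (ω := ω) hb
  have hcont : Continuous fun θ : Circ => disp (skew ω b g) N (θ, 0) :=
    (continuous_snd.comp (((continuous_skew hb hg.continuous).iterate N).comp
      (by fun_prop : Continuous fun θ : Circ => (θ, (0 : ℝ))))).sub continuous_const
  obtain ⟨δ, hδ, hunif⟩ := Metric.uniformContinuous_iff.1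
    (CompactSpace.uniformContinuous_of_continuous hcont) 1 one_pos
  obtain ⟨J, hJ⟩ := exists_le_forall_exists_dist_add_nsmul_lt hω hδ
  refine ⟨2 * (J * C), fun k z z' => ?_⟩
  obtain ⟨j, hj, hdist⟩ := hJ z.1 z'.1
  have hshift := (abs_le.1 (abs_disp_iterate_sub_le hC (k * N) j z)).1
  have hclose := (abs_le.1 (hg.abs_disp_mul_sub_disp_mul_le (fun θ θ' h => (hunif h).le) k
    (z := (skew ω b g)^[j] z) (z' := z') (by rwa [iterate_skew_fst]))).2
  have hjC : (j : ℝ) * C ≤ J * C :=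
    mul_le_mul_of_nonneg_right (Nat.cast_le.2 hj) ((abs_nonneg _).trans (hC 0))
  linarith

theorem tendstoUniformly_avgDisp_of_tendsto_iSup {F : Circ × ℝ → Circ × ℝ} {C ρ : ℝ}
    (hC : ∀ n z, |disp F n z| ≤ n * C)
    (hupp : Tendsto (fun n : ℕ => (⨆ z, disp F n z) / n) atTop (𝓝 ρ))
    (hlow : Tendsto (fun n : ℕ => (⨆ z, -disp F n z) / n) atTop (𝓝 (-ρ))) :
    TendstoUniformly (avgDisp F) (fun _ => ρ) atTop := by
  refine Metric.tendstoUniformly_iff.2 fun ε hε => ?_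
  filter_upwards [hupp.eventually (gt_mem_nhds (lt_add_of_pos_right ρ hε)),
    hlow.eventually (gt_mem_nhds (lt_add_of_pos_right (-ρ) hε))] with n hn hn' z
  have hle : avgDisp F n z ≤ (⨆ w, disp F n w) / n := by
    rw [avgDisp_eq]
    gcongr
    exact le_iSup_of_forall_abs_le (hC n) z
  have hge : -avgDisp F n z ≤ (⨆ w, -disp F n w) / n := by
    rw [avgDisp_eq, ← neg_div]
    gcongr
    exact le_iSup_of_forall_abs_le (B := n * C) (fun w => by rw [abs_neg]; exact hC n w) z
  rw [Real.dist_eq, abs_lt]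
  constructor <;> linarith

theorem IsMonoLift.exists_tendstoUniformly_avgDisp (hg : IsMonoLift g) (hb : Continuous b)
    (hω : DenseRange fun n : ℕ => n • ω) :
    ∃ ρ : ℝ, TendstoUniformly (avgDisp (skew ω b g)) (fun _ => ρ) atTop := by
  set F := skew ω b g
  obtain ⟨C, hC₁⟩ := hg.exists_abs_disp_le (ω := ω) hb
  have hC := abs_disp_le hC₁
  have hC' (n : ℕ) (z : Circ × ℝ) : |-disp F n z| ≤ n * C := by
    rw [abs_neg]
    exact hC n z
  obtain ⟨ρ, hρ⟩ := exists_tendsto_iSup_div (disp_add F) hC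
  obtain ⟨σ, hσ⟩ := exists_tendsto_iSup_div (T := F) (a := fun n z => -disp F n z)
    (fun m n z => by rw [disp_add F, neg_add]) hC'
  have hsum : Tendsto (fun n : ℕ => ((⨆ z, disp F n z) + ⨆ z, -disp F n z) / n) atTop
      (𝓝 (ρ + σ)) := by
    simpa only [add_div] using hρ.add hσ
  have hnonneg : 0 ≤ ρ + σ := ge_of_tendsto' hsum fun n => by
    have hpos := le_iSup_of_forall_abs_le (hC n) 0
    have hneg := le_iSup_of_forall_abs_le (hC' n) 0
    exact div_nonneg (by linarith) n.cast_nonneg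
  have hnonpos : ρ + σ ≤ 0 := by
    refine ge_of_tendsto (tendsto_const_div_atTop_nhds_zero_nat 3) ?_
    filter_upwards [eventually_gt_atTop 0] with N hN
    obtain ⟨K, hK⟩ := hg.exists_disp_mul_sub_disp_mul_le hb hω N
    exact le_div_of_tendsto_div (K := K) hN hsum fun k =>
      ciSup_add_ciSup_le fun z z' => by linarith [hK k z z']
  refine ⟨ρ, tendstoUniformly_avgDisp_of_tendsto_iSup hC hρ ?_⟩
  rwa [show -ρ = σ by linarith]

theorem IsMonoLift.tendstoUniformly_fibRotNum (hg : IsMonoLift g) (hb : Continuous b)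
    (hω : DenseRange fun n : ℕ => n • ω) :
    TendstoUniformly (avgDisp (skew ω b g)) (fun _ => fibRotNum (skew ω b g)) atTop := by
  obtain ⟨ρ, hρ⟩ := hg.exists_tendstoUniformly_avgDisp hb hω
  rwa [fibRotNum, (hρ.tendsto_at 0).limUnder_eq]

theorem IsMonoLift.tendsto_fibRotNum (hg : IsMonoLift g) (hb : Continuous b)
    (hω : DenseRange fun n : ℕ => n • ω) (z : Circ × ℝ) :
    Tendsto (fun n => avgDisp (skew ω b g) n z) atTop (𝓝 (fibRotNum (skew ω b g))) :=
  (hg.tendstoUniformly_fibRotNum hb hω).tendsto_at z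

/-- Closeness of the `N`-step displacements on the zero section persists, up to `3 / N`, for the
averages on whole fibres, and these bound the distance of the rotation numbers. -/
theorem continuous_fibRotNum {P : Type*} [TopologicalSpace P] {g : P → ℝ → ℝ}
    (hg : ∀ p, IsMonoLift (g p)) (hcont : Continuous fun p : P × ℝ => g p.1 p.2)
    (hb : Continuous b) (hω : DenseRange fun n : ℕ => n • ω) :
    Continuous fun p => fibRotNum (skew ω b (g p)) := by
  refine continuous_iff_continuousAt.2 fun p => Metric.tendsto_nhds.2 fun ε hε => ?_
  obtain ⟨N, hNp, hN, hNε⟩ := ((Metric.tendstoUniformly_iff.1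
    ((hg p).tendstoUniformly_fibRotNum hb hω) (ε / 3) (by positivity)).and
    ((eventually_gt_atTop 0).and ((tendsto_const_div_atTop_nhds_zero_nat (3 : ℝ)).eventually
      (gt_mem_nhds (show 0 < ε / 3 by positivity))))).exists
  have : (0 : ℝ) < N := Nat.cast_pos.2 hN
  have hsec : Continuous fun q : P × Circ => disp (skew ω b (g q.1)) N (q.2, 0) :=
    (continuous_snd.comp ((continuous_iterate_skew hb hcont N).comp
      (by fun_prop : Continuous fun q : P × Circ => (q.1, (q.2, (0 : ℝ)))))).sub continuous_const
  have hunif : TendstoUniformly (fun q θ => disp (skew ω b (g q)) N (θ, 0))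
      (fun θ => disp (skew ω b (g p)) N (θ, 0)) (𝓝 p) :=
    ContinuousMap.tendsto_iff_tendstoUniformly.1
      ((ContinuousMap.curry ⟨_, hsec⟩).continuous.tendsto p)
  filter_upwards [Metric.tendstoUniformly_iff.1 hunif 1 one_pos] with q hq
  refine (abs_sub_le_of_tendsto_avgDisp hN ((hg q).tendsto_fibRotNum hb hω 0)
    (ε := 2 * (ε / 3)) fun z => ?_).trans_lt (by linarith)
  have hfib : |disp (skew ω b (g p)) N z - disp (skew ω b (g q)) N z| ≤ 3 := by
    have hp := abs_le.1 ((hg p).abs_disp_sub_disp_le (ω := ω) (b := b) N z.1 z.2 0)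
    have hq' := abs_le.1 ((hg q).abs_disp_sub_disp_le (ω := ω) (b := b) N z.1 z.2 0)
    have hpq := abs_lt.1 (hq z.1)
    rw [Prod.mk.eta] at hp hq'
    rw [abs_le]
    constructor <;> linarith [hp.1, hp.2, hq'.1, hq'.2, hpq.1, hpq.2]
  have havg : |avgDisp (skew ω b (g p)) N z - avgDisp (skew ω b (g q)) N z| ≤ 3 / N := by
    rw [avgDisp_eq, avgDisp_eq, ← sub_div, abs_div, Nat.abs_cast]
    gcongr
  have hz := abs_lt.1 (hNp z)
  rw [abs_le] at havg ⊢
  constructor <;> linarith [havg.1, havg.2, hz.1, hz.2]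

theorem IsMonoLift.iterate_skew_snd_add_le (hg : IsMonoLift g) {h : ℝ → ℝ}
    (hgap : ∀ x, h x + 1 ≤ g x) (n : ℕ) (z : Circ × ℝ) :
    ((skew ω b h)^[n] z).2 + n ≤ ((skew ω b g)^[n] z).2 := by
  induction n with
  | zero => simp
  | succ n ih =>
    rw [iterate_succ_skew_snd, iterate_succ_skew_snd, Nat.cast_succ]
    have hmono := hg.monotone ih
    have hshift := hg.map_add_int ((skew ω b h)^[n] z).2 n
    rw [Int.cast_natCast] at hshift
    linarith [hgap ((skew ω b h)^[n] z).2]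

theorem fibRotNum_add_one_le {h : ℝ → ℝ} (hh : IsMonoLift h) (hg : IsMonoLift g)
    (hgap : ∀ x, h x + 1 ≤ g x) (hb : Continuous b) (hω : DenseRange fun n : ℕ => n • ω) :
    fibRotNum (skew ω b h) + 1 ≤ fibRotNum (skew ω b g) := by
  refine le_of_tendsto_of_tendsto ((hh.tendsto_fibRotNum hb hω 0).add_const 1)
    (hg.tendsto_fibRotNum hb hω 0) ?_
  filter_upwards [eventually_gt_atTop 0] with n hn
  have hn' : (0 : ℝ) < n := Nat.cast_pos.2 hn
  rw [avgDisp, avgDisp, div_add_one hn'.ne']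
  gcongr
  linarith [hg.iterate_skew_snd_add_le (ω := ω) (b := b) hgap n 0]

end Rotation

/-- The running supremum of a lift: its smallest monotone majorant. -/
def runSup (H : ℝ → ℝ) (x : ℝ) : ℝ := sSup (H '' Iic x)

/-- The running infimum of a lift: its largest monotone minorant. -/
def runInf (H : ℝ → ℝ) (x : ℝ) : ℝ := sInf (H '' Ici x)

/-- The open set of points near which `g` is constant. -/
def plateau (g : ℝ → ℝ) : Set ℝ := {x | ∀ᶠ y in 𝓝 x, g y = g x}

section RunSup

variable {H : ℝ → ℝ} {x y c : ℝ}

theorem runSup_le (h : ∀ y ≤ x, H y ≤ c) : runSup H x ≤ c :=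
  csSup_le (nonempty_Iic.image H) (forall_mem_image.2 h)

theorem le_runInf (h : ∀ y, x ≤ y → c ≤ H y) : c ≤ runInf H x :=
  le_csInf (nonempty_Ici.image H) (forall_mem_image.2 fun y => h y)

theorem IsDegOneLift.exists_isGreatest_image_Iic (hH : IsDegOneLift H) (x : ℝ) :
    ∃ t ∈ Icc (x - 1) x, IsGreatest (H '' Iic x) (H t) := by
  obtain ⟨t, ht, hmax⟩ := isCompact_Icc.exists_isMaxOn
    (nonempty_Icc.2 (sub_one_lt x).le) hH.continuous.continuousOn
  refine ⟨t, ht, mem_image_of_mem H ht.2, forall_mem_image.2 fun y hy => ?_⟩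
  have hfloor : (0 : ℝ) ≤ ⌊x - y⌋ := Int.cast_nonneg (Int.floor_nonneg.2 (sub_nonneg.2 hy))
  calc H y ≤ H (y + ⌊x - y⌋) := by rw [hH.map_add_int]; linarith
    _ ≤ H t := hmax ⟨by linarith [Int.lt_floor_add_one (x - y)], by linarith [Int.floor_le (x - y)]⟩

theorem IsDegOneLift.exists_runSup_eq (hH : IsDegOneLift H) (x : ℝ) :
    ∃ t ∈ Icc (x - 1) x, runSup H x = H t := by
  obtain ⟨t, ht, hmax⟩ := hH.exists_isGreatest_image_Iic x
  exact ⟨t, ht, hmax.csSup_eq⟩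

theorem IsDegOneLift.le_runSup (hH : IsDegOneLift H) (h : y ≤ x) : H y ≤ runSup H x := by
  obtain ⟨t, -, hmax⟩ := hH.exists_isGreatest_image_Iic x
  exact le_csSup ⟨_, hmax.2⟩ (mem_image_of_mem H h)

theorem IsDegOneLift.runSup_eq_sSup_image_Icc (hH : IsDegOneLift H) (x : ℝ) :
    runSup H x = sSup ((fun s => H (x - s)) '' Icc 0 1) := by
  obtain ⟨t, ht, hmax⟩ := hH.exists_isGreatest_image_Iic x
  have hwindow : IsGreatest ((fun s => H (x - s)) '' Icc 0 1) (H t) :=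
    ⟨⟨x - t, ⟨sub_nonneg.2 ht.2, by linarith [ht.1]⟩, by simp only [sub_sub_cancel]⟩,
      forall_mem_image.2 fun s hs => hmax.2 (mem_image_of_mem H (sub_le_self x hs.1))⟩
  exact hmax.csSup_eq.trans hwindow.csSup_eq.symm

theorem continuous_runSup {P : Type*} [TopologicalSpace P] {H : P → ℝ → ℝ}
    (hH : ∀ p, IsDegOneLift (H p)) (hcont : Continuous fun q : P × ℝ => H q.1 q.2) :
    Continuous fun q : P × ℝ => runSup (H q.1) q.2 := by
  simp only [fun q : P × ℝ => (hH q.1).runSup_eq_sSup_image_Icc q.2]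
  refine isCompact_Icc.continuous_sSup (f := fun (q : P × ℝ) s => H q.1 (q.2 - s)) ?_
  exact hcont.comp (by fun_prop : Continuous fun r : (P × ℝ) × ℝ => (r.1.1, r.1.2 - r.2))

theorem IsDegOneLift.isMonoLift_runSup (hH : IsDegOneLift H) : IsMonoLift (runSup H) where
  continuous := (continuous_runSup (fun _ : Unit => hH) (hH.continuous.comp continuous_snd)).comp
    (Continuous.prodMk_right ())
  map_add_one x := by
    refine le_antisymm (runSup_le fun y hy => ?_) ?_
    · have hy' := hH.le_runSup (sub_le_iff_le_add.2 hy)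
      have hstep := hH.map_add_one (y - 1)
      rw [sub_add_cancel] at hstep
      linarith
    · obtain ⟨t, ht, hmax⟩ := hH.exists_runSup_eq x
      rw [hmax, ← hH.map_add_one]
      exact hH.le_runSup (by linarith [ht.2])
  monotone _ _ hxy := runSup_le fun _ hw => hH.le_runSup (hw.trans hxy)

theorem IsMonoLift.runSup_eq (hH : IsMonoLift H) : runSup H = H :=
  funext fun _ => le_antisymm (runSup_le fun _ h => hH.monotone h) (hH.le_runSup le_rfl)

theorem IsDegOneLift.eventually_runSup_le (hH : IsDegOneLift H)
    (h : ∀ᶠ y in 𝓝 x, H y ≤ runSup H x) : ∀ᶠ y in 𝓝 x, runSup H y ≤ runSup H x := by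
  obtain ⟨ε, hε, hball⟩ := Metric.eventually_nhds_iff_ball.1 h
  filter_upwards [Metric.ball_mem_nhds x hε] with y hy
  refine runSup_le fun w hw => ?_
  rcases le_or_gt w x with hwx | hwx
  · exact hH.le_runSup hwx
  · rw [Real.ball_eq_Ioo] at hy hball
    exact hball w ⟨by linarith, by linarith [hy.2]⟩

theorem IsDegOneLift.mem_plateau_runSup (hH : IsDegOneLift H) (h : H x < runSup H x) :
    x ∈ plateau (runSup H) := by
  obtain ⟨t, ht, hmax⟩ := hH.exists_runSup_eq x
  have htx : t < x := ht.2.lt_of_ne fun htx => h.ne' (htx ▸ hmax)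
  filter_upwards [hH.eventually_runSup_le (((hH.continuous.tendsto x).eventually
    (gt_mem_nhds h)).mono fun _ => le_of_lt), lt_mem_nhds htx] with y hy hty
  exact hy.antisymm (hmax ▸ hH.le_runSup hty.le)

theorem IsDegOneLift.neg_comp_neg (hH : IsDegOneLift H) : IsDegOneLift fun y => -H (-y) where
  continuous := (hH.continuous.comp continuous_neg).neg
  map_add_one x := by
    have h := hH.map_add_one (-(x + 1))
    rw [neg_add_rev, neg_add_cancel_comm] at h
    rw [neg_add_rev]
    linarith

theorem runInf_eq_neg_runSup (H : ℝ → ℝ) (x : ℝ) :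
    runInf H x = -runSup (fun y => -H (-y)) (-x) := by
  rw [runInf, Real.sInf_def, runSup]
  congr 2
  ext s
  simp only [Set.mem_neg, mem_image, mem_Ici, mem_Iic]
  constructor
  · rintro ⟨y, hy, hys⟩
    exact ⟨-y, neg_le_neg hy, by rw [neg_neg, hys, neg_neg]⟩
  · rintro ⟨y, hy, hys⟩
    exact ⟨-y, le_neg.1 hy, by rw [← hys, neg_neg]⟩

theorem IsDegOneLift.runInf_le (hH : IsDegOneLift H) (h : x ≤ y) : runInf H x ≤ H y := by
  rw [runInf_eq_neg_runSup, neg_le]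
  simpa only [neg_neg] using hH.neg_comp_neg.le_runSup (neg_le_neg h)

theorem IsDegOneLift.isMonoLift_runInf (hH : IsDegOneLift H) : IsMonoLift (runInf H) where
  toIsDegOneLift := by
    simpa only [← runInf_eq_neg_runSup] using
      hH.neg_comp_neg.isMonoLift_runSup.toIsDegOneLift.neg_comp_neg
  monotone _ _ hxy := le_runInf fun _ hw => hH.runInf_le (hxy.trans hw)

theorem IsDegOneLift.mem_plateau_runInf (hH : IsDegOneLift H) (h : runInf H x < H x) :
    x ∈ plateau (runInf H) := by
  have hneg : -x ∈ plateau (runSup fun y => -H (-y)) := by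
    refine hH.neg_comp_neg.mem_plateau_runSup ?_
    rw [runInf_eq_neg_runSup] at h
    rw [neg_neg]
    linarith
  filter_upwards [(continuous_neg.tendsto x).eventually hneg] with y hy
  rw [runInf_eq_neg_runSup, runInf_eq_neg_runSup, hy]

theorem IsDegOneLift.exists_le_runInf_add (hH : IsDegOneLift H) :
    ∃ R, ∀ x, H x ≤ runInf H x + R := by
  obtain ⟨C, hC⟩ := hH.exists_abs_sub_le
  obtain ⟨D, hD⟩ := hH.isMonoLift_runInf.exists_abs_sub_le
  exact ⟨C + D, fun x => by linarith [(abs_le.1 (hC x)).2, (abs_le.1 (hD x)).1]⟩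

end RunSup

/-- The running infimum of `G` raised by `μ`, cut off at `G` and made monotone again. As `μ` grows
this deforms `runInf G` into `runSup G` through monotone lifts that agree with `G` off their
plateaus. -/
def pour (G : ℝ → ℝ) (μ : ℝ) : ℝ → ℝ := runSup fun y => min (G y) (runInf G y + μ)

section Pour

variable {G : ℝ → ℝ}

theorem IsDegOneLift.min_runInf_add (hG : IsDegOneLift G) (μ : ℝ) :
    IsDegOneLift fun y => min (G y) (runInf G y + μ) where
  continuous := hG.continuous.min (hG.isMonoLift_runInf.continuous.add_const μ)
  map_add_one x := by
    rw [hG.map_add_one, hG.isMonoLift_runInf.map_add_one, add_right_comm, min_add_add_right]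

theorem IsDegOneLift.isMonoLift_pour (hG : IsDegOneLift G) (μ : ℝ) : IsMonoLift (pour G μ) :=
  (hG.min_runInf_add μ).isMonoLift_runSup

theorem IsDegOneLift.continuous_pour (hG : IsDegOneLift G) :
    Continuous fun p : ℝ × ℝ => pour G p.1 p.2 := by
  refine continuous_runSup hG.min_runInf_add ?_
  have hcont := hG.continuous
  have hinf := hG.isMonoLift_runInf.continuous
  fun_prop

theorem IsDegOneLift.pour_zero (hG : IsDegOneLift G) : pour G 0 = runInf G := by
  simp only [pour, add_zero, min_eq_right (hG.runInf_le le_rfl)]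
  exact hG.isMonoLift_runInf.runSup_eq

theorem pour_eq_runSup {R : ℝ} (hR : ∀ x, G x ≤ runInf G x + R) : pour G R = runSup G := by
  simp only [pour, min_eq_left (hR _)]

theorem IsDegOneLift.mem_plateau_pour (hG : IsDegOneLift G) {μ : ℝ} (hμ : 0 ≤ μ) {x : ℝ}
    (h : pour G μ x ≠ G x) : x ∈ plateau (pour G μ) := by
  have hH := hG.min_runInf_add μ
  rcases (hH.le_runSup (le_refl x)).lt_or_eq with hlt | heq
  · exact hH.mem_plateau_runSup hlt
  have hlt : runInf G x + μ < G x := by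
    by_contra! hle
    exact h (heq.symm.trans (min_eq_left hle))
  have hlevel : ∀ᶠ y in 𝓝 x, min (G y) (runInf G y + μ) = pour G μ x := by
    filter_upwards [hG.mem_plateau_runInf (show runInf G x < G x by linarith),
      (hG.continuous.tendsto x).eventually (lt_mem_nhds hlt)] with y hy hy'
    rw [hy, min_eq_right hy'.le]
    exact (min_eq_right hlt.le).symm.trans heq
  filter_upwards [hlevel, hH.eventually_runSup_le (hlevel.mono fun _ hy => hy.le)] with y hy hy'
  exact hy'.antisymm (hy.ge.trans (hH.le_runSup le_rfl))

end Pour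

section Proj

theorem isOpenQuotientMap_proj : IsOpenQuotientMap proj :=
  IsOpenQuotientMap.id.prodMap QuotientAddGroup.isOpenQuotientMap_mk

theorem coe_add_int (x : ℝ) (k : ℤ) : ((x + k : ℝ) : Circ) = x := by
  have hk : ((k : ℝ) : Circ) = 0 := (AddCircle.coe_eq_zero_iff 1).2 ⟨k, by simp⟩
  rw [AddCircle.coe_add, hk, add_zero]

theorem proj_eq_proj_iff {z w : Circ × ℝ} : proj z = proj w ↔ ∃ k : ℤ, z = (w.1, w.2 + k) := by
  constructor
  · intro h
    obtain ⟨hfst, hsnd⟩ := Prod.ext_iff.1 h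
    have hsub : ((z.2 - w.2 : ℝ) : Circ) = 0 := by
      rw [AddCircle.coe_sub, sub_eq_zero]
      exact hsnd
    obtain ⟨k, hk⟩ := (AddCircle.coe_eq_zero_iff 1).1 hsub
    rw [zsmul_eq_mul, mul_one] at hk
    exact ⟨k, Prod.ext hfst (by rw [hk, add_sub_cancel])⟩
  · rintro ⟨k, rfl⟩
    exact Prod.ext rfl (coe_add_int w.2 k)

variable {f : Circ × Circ → Circ × Circ}

theorem continuous_of_isLift {F : Circ × ℝ → Circ × ℝ} (hF : IsLift f F) : Continuous f := by
  have hcomp : f ∘ proj = proj ∘ F := (funext hF.semiconj).symm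
  rw [isOpenQuotientMap_proj.isQuotientMap.continuous_iff, hcomp]
  exact isOpenQuotientMap_proj.continuous.comp hF.continuous

theorem fst_apply_of_isLift {ω : Circ} {b : Circ → ℝ} {G : ℝ → ℝ} (hf : IsLift f (skew ω b G))
    (w : Circ × Circ) : (f w).1 = w.1 + ω := by
  obtain ⟨z, rfl⟩ := isOpenQuotientMap_proj.surjective w
  rw [← hf.semiconj]
  rfl

end Proj

/-- The set of points whose forward orbit under the skew product avoids the plateaus of its fibre
map. -/
def avoidSet (ω : Circ) (b : Circ → ℝ) (g : ℝ → ℝ) : Set (Circ × ℝ) :=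
  {z | ∀ n, ((skew ω b g)^[n] z).2 ∉ plateau g}

section AvoidSet

variable {ω : Circ} {b : Circ → ℝ} {g G : ℝ → ℝ}

theorem isOpen_plateau (g : ℝ → ℝ) : IsOpen (plateau g) := by
  refine isOpen_iff_mem_nhds.2 fun x hx => ?_
  filter_upwards [eventually_eventually_nhds.2 hx, hx] with y hy hyx
  exact hy.mono fun w hw => hw.trans hyx.symm

theorem IsDegOneLift.add_int_mem_plateau_iff (hg : IsDegOneLift g) {x : ℝ} {k : ℤ} :
    x + k ∈ plateau g ↔ x ∈ plateau g := by
  change (∀ᶠ y in 𝓝 (x + k), g y = g (x + k)) ↔ ∀ᶠ y in 𝓝 x, g y = g x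
  rw [← map_add_right_nhds, eventually_map]
  simp only [hg.map_add_int, add_left_inj]

theorem skew_mem_avoidSet {z : Circ × ℝ} (hz : z ∈ avoidSet ω b g) :
    skew ω b g z ∈ avoidSet ω b g := fun n => hz (n + 1)

theorem isClosed_avoidSet (hb : Continuous b) (hg : Continuous g) :
    IsClosed (avoidSet ω b g) := by
  simp only [avoidSet, ofPred_forall]
  exact isClosed_iInter fun n => (isOpen_plateau g).isClosed_compl.preimage
    (continuous_snd.comp ((continuous_skew hb hg).iterate n))

theorem IsDegOneLift.add_int_mem_avoidSet (hg : IsDegOneLift g) {z : Circ × ℝ}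
    (hz : z ∈ avoidSet ω b g) (k : ℤ) : (z.1, z.2 + k) ∈ avoidSet ω b g := fun n hn => by
  rw [(hg.iterate_skew n z.1).map_add_int, hg.add_int_mem_plateau_iff] at hn
  exact hz n hn

theorem IsDegOneLift.preimage_image_proj_avoidSet (hg : IsDegOneLift g) :
    proj ⁻¹' (proj '' avoidSet ω b g) = avoidSet ω b g := by
  refine Subset.antisymm ?_ (subset_preimage_image _ _)
  rintro z ⟨w, hw, hwz⟩
  obtain ⟨k, rfl⟩ := proj_eq_proj_iff.1 hwz.symm
  exact hg.add_int_mem_avoidSet hw k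

theorem IsDegOneLift.isClosed_image_proj_avoidSet (hg : IsDegOneLift g) (hb : Continuous b) :
    IsClosed (proj '' avoidSet ω b g) := by
  rw [← isOpenQuotientMap_proj.isQuotientMap.isClosed_preimage, hg.preimage_image_proj_avoidSet]
  exact isClosed_avoidSet hb hg.continuous

theorem IsDegOneLift.mem_plateau_iterate_skew (hg : IsDegOneLift g) {θ : Circ} {x : ℝ} {i n : ℕ}
    (hin : i < n) (hi : ((skew ω b g)^[i] (θ, x)).2 ∈ plateau g) :
    x ∈ plateau fun y => ((skew ω b g)^[n] (θ, y)).2 := by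
  induction n, Nat.succ_le_of_lt hin using Nat.le_induction with
  | base =>
    filter_upwards [((hg.iterate_skew (ω := ω) (b := b) i θ).continuous.tendsto x).eventually hi]
      with y hy
    rw [Nat.succ_eq_add_one, iterate_succ_skew_snd, iterate_succ_skew_snd, hy]
  | succ n hn ih =>
    filter_upwards [ih hn] with y hy
    rw [iterate_succ_skew_snd, iterate_succ_skew_snd, hy]

/-- Otherwise, by compactness, some iterate would be locally constant on the fibre, although it is
a lift of degree one. -/
theorem IsDegOneLift.exists_mem_avoidSet (hg : IsDegOneLift g) (θ : Circ) :
    ∃ x, (θ, x) ∈ avoidSet ω b g := by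
  have hiter (n : ℕ) := hg.iterate_skew (ω := ω) (b := b) n θ
  by_contra! hcon
  have hcover : Icc (0 : ℝ) 1 ⊆ ⋃ i, (fun x => ((skew ω b g)^[i] (θ, x)).2) ⁻¹' plateau g := by
    intro x _
    simpa only [avoidSet, mem_ofPred_eq, not_forall, not_not, mem_iUnion, mem_preimage] using hcon x
  obtain ⟨s, hs⟩ := isCompact_Icc.elim_finite_subcover _
    (fun i => (isOpen_plateau g).preimage (hiter i).continuous) hcover
  have hloc : IsLocallyConstant fun x => ((skew ω b g)^[s.sup id + 1] (θ, x)).2 := by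
    refine (IsLocallyConstant.iff_eventually_eq _).2 fun x => ?_
    obtain ⟨i, hi, hplateau⟩ := mem_iUnion₂.1
      (hs ⟨Int.fract_nonneg x, (Int.fract_lt_one x).le⟩)
    have hlt : i < s.sup id + 1 := Nat.lt_succ_of_le (Finset.le_sup (f := id) hi)
    refine hg.mem_plateau_iterate_skew hlt ?_
    rw [← Int.fract_add_floor x, (hiter i).map_add_int, hg.add_int_mem_plateau_iff]
    exact hplateau
  have hconst := hloc.apply_eq_of_preconnectedSpace (0 + 1) 0
  rw [(hiter _).map_add_one] at hconst
  exact (lt_add_one _).ne' hconst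

theorem iterate_skew_eq_of_mem_avoidSet (hgG : ∀ x ∉ plateau g, g x = G x) {z : Circ × ℝ}
    (hz : z ∈ avoidSet ω b g) (n : ℕ) : (skew ω b G)^[n] z = (skew ω b g)^[n] z := by
  induction n with
  | zero => rfl
  | succ n ih =>
    rw [Function.iterate_succ_apply', Function.iterate_succ_apply', ih, skew, skew, hgG _ (hz n)]

theorem avgDisp_skew_eq_of_mem_avoidSet (hgG : ∀ x ∉ plateau g, g x = G x) {z : Circ × ℝ}
    (hz : z ∈ avoidSet ω b g) (n : ℕ) : avgDisp (skew ω b G) n z = avgDisp (skew ω b g) n z := by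
  rw [avgDisp, avgDisp, iterate_skew_eq_of_mem_avoidSet hgG hz]

end AvoidSet

section RotationInterval

variable {ω : Circ} {b : Circ → ℝ} {G : ℝ → ℝ}

/-- Pouring moves the rotation number continuously between its two extremes. -/
theorem IsDegOneLift.exists_isMonoLift_fibRotNum_eq (hG : IsDegOneLift G) (hb : Continuous b)
    (hω : DenseRange fun n : ℕ => n • ω) {ρ : ℝ}
    (hρ : ρ ∈ Icc (fibRotNum (skew ω b (runInf G))) (fibRotNum (skew ω b (runSup G)))) :
    ∃ g, IsMonoLift g ∧ (∀ x ∉ plateau g, g x = G x) ∧ fibRotNum (skew ω b g) = ρ := by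
  obtain ⟨R, hR⟩ := hG.exists_le_runInf_add
  have hR₀ : 0 ≤ R := by linarith [hR 0, hG.runInf_le (le_refl 0)]
  have hcont : Continuous fun μ => fibRotNum (skew ω b (pour G μ)) :=
    continuous_fibRotNum hG.isMonoLift_pour hG.continuous_pour hb hω
  rw [← hG.pour_zero, ← pour_eq_runSup hR] at hρ
  obtain ⟨μ, hμ, rfl⟩ := intermediate_value_Icc hR₀ hcont.continuousOn hρ
  exact ⟨pour G μ, hG.isMonoLift_pour μ,
    fun x hx => not_imp_comm.1 (hG.mem_plateau_pour hμ.1) hx, rfl⟩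

theorem IsDegOneLift.fibRot_skew_eq_Icc (hG : IsDegOneLift G) (hb : Continuous b)
    (hω : DenseRange fun n : ℕ => n • ω) :
    fibRot (skew ω b G) =
      Icc (fibRotNum (skew ω b (runInf G))) (fibRotNum (skew ω b (runSup G))) := by
  have hinf := hG.isMonoLift_runInf
  have hsup := hG.isMonoLift_runSup
  refine Subset.antisymm ?_ fun ρ hρ => ?_
  · rintro _ ⟨z, rfl⟩
    have hle (n : ℕ) : avgDisp (skew ω b (runInf G)) n z ≤ avgDisp (skew ω b G) n z :=
      avgDisp_skew_le_avgDisp_skew (Or.inl hinf.monotone) (fun x => hG.runInf_le le_rfl) n z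
    have hge (n : ℕ) : avgDisp (skew ω b G) n z ≤ avgDisp (skew ω b (runSup G)) n z :=
      avgDisp_skew_le_avgDisp_skew (Or.inr hsup.monotone) (fun x => hG.le_runSup le_rfl) n z
    have hlim := hinf.tendsto_fibRotNum hb hω z
    have hlim' := hsup.tendsto_fibRotNum hb hω z
    have hbdd := hlim'.isBoundedUnder_le.mono_le (Eventually.of_forall hge)
    have hbdd' := hlim.isBoundedUnder_ge.mono_ge (Eventually.of_forall hle)
    rw [← hlim.limsup_eq, ← hlim'.limsup_eq]
    exact ⟨limsup_le_limsup (Eventually.of_forall hle)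
        hlim.isBoundedUnder_ge.isCoboundedUnder_le hbdd,
      limsup_le_limsup (Eventually.of_forall hge) hbdd'.isCoboundedUnder_le
        hlim'.isBoundedUnder_le⟩
  · obtain ⟨g, hg, hgG, rfl⟩ := hG.exists_isMonoLift_fibRotNum_eq hb hω hρ
    obtain ⟨x, hx⟩ := hg.exists_mem_avoidSet (ω := ω) (b := b) 0
    refine ⟨(0, x), ?_⟩
    simp only [avgDisp_skew_eq_of_mem_avoidSet hgG hx]
    exact (hg.tendsto_fibRotNum hb hω (0, x)).limsup_eq.symm

end RotationInterval

section MinimalSet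

theorem exists_isMinimalSet_subset {X : Type*} [TopologicalSpace X] {f : X → X} {K : Set X}
    (hne : K.Nonempty) (hcpt : IsCompact K) (hcl : IsClosed K) (hK : MapsTo f K K) :
    ∃ M ⊆ K, IsMinimalSet f M := by
  obtain ⟨M, hMK, hM⟩ := zorn_superset_nonempty
    {N : Set X | N.Nonempty ∧ IsClosed N ∧ MapsTo f N N ∧ N ⊆ K} (by
      intro c hc hchain hcne
      have := hcne.to_subtype
      refine ⟨⋂₀ c, ⟨?_, isClosed_sInter fun s hs => (hc hs).2.1,
        fun x hx s hs => (hc hs).2.2.1 (hx s hs),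
        (sInter_subset_of_mem hcne.some_mem).trans (hc hcne.some_mem).2.2.2⟩,
        fun s hs => sInter_subset_of_mem hs⟩
      rw [sInter_eq_iInter]
      refine IsCompact.nonempty_iInter_of_directed_nonempty_isCompact_isClosed _ ?_
        (fun s => (hc s.2).1) (fun s => hcpt.of_isClosed_subset (hc s.2).2.1 (hc s.2).2.2.2)
        (fun s => (hc s.2).2.1)
      exact fun s t => (hchain.total s.2 t.2).elim (fun h => ⟨s, Subset.rfl, h⟩)
        fun h => ⟨t, h, Subset.rfl⟩) K ⟨hne, hcl, hK, Subset.rfl⟩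
  exact ⟨M, hMK, hM.prop.1, hM.prop.2.1, hM.prop.2.2.1, fun N hN hne' hcl' hmaps =>
    hN.antisymm (hM.le_of_le ⟨hne', hcl', hmaps, hN.trans hMK⟩ hN)⟩

/-- Off the plateaus of `g` the torus map is the projection of the monotone skew product, so a
minimal set in the image of `avoidSet ω b g` inherits the rotation number of the latter. -/
theorem IsMonoLift.exists_isMinimalSet_hasUniformRotation {ω : Circ} {b : Circ → ℝ}
    {g G : ℝ → ℝ} (hg : IsMonoLift g) (hgG : ∀ x ∉ plateau g, g x = G x) (hb : Continuous b)
    (hω : DenseRange fun n : ℕ => n • ω) {f : Circ × Circ → Circ × Circ}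
    (hf : IsLift f (skew ω b G)) :
    ∃ M, IsMinimalSet f M ∧ proj ⁻¹' M ⊆ avoidSet ω b g ∧
      HasUniformRotation (skew ω b G) M (fibRotNum (skew ω b g)) := by
  have hcl := hg.isClosed_image_proj_avoidSet (ω := ω) hb
  obtain ⟨x, hx⟩ := hg.exists_mem_avoidSet (ω := ω) (b := b) 0
  have hinv : MapsTo f (proj '' avoidSet ω b g) (proj '' avoidSet ω b g) := by
    rintro _ ⟨z, hz, rfl⟩
    rw [← hf.semiconj, ← Function.iterate_one (skew ω b G),
      iterate_skew_eq_of_mem_avoidSet hgG hz]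
    exact mem_image_of_mem proj (skew_mem_avoidSet hz)
  obtain ⟨M, hMK, hM⟩ :=
    exists_isMinimalSet_subset ⟨_, mem_image_of_mem proj hx⟩ hcl.isCompact hcl hinv
  have havoid : proj ⁻¹' M ⊆ avoidSet ω b g :=
    (preimage_mono hMK).trans hg.preimage_image_proj_avoidSet.subset
  refine ⟨M, hM, havoid, ?_⟩
  exact (hg.tendstoUniformly_fibRotNum hb hω).tendstoUniformlyOn.congr
    (Eventually.of_forall fun n z hz => (avgDisp_skew_eq_of_mem_avoidSet hgG (havoid hz) n).symm)

end MinimalSet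

section Itinerary

variable {ω : Circ} {b : Circ → ℝ} {g : ℝ → ℝ} {N L : ℕ} {θ θ' : Circ} {x y : ℝ}

/-- The itinerary of length `N` of a point of a fibre with respect to the partition into intervals
of length `1 / L`, summed up in one integer: by monotonicity, two points of the fibre have the same
itinerary as soon as the two sums agree. -/
def itinerary (F : Circ × ℝ → Circ × ℝ) (N L : ℕ) (θ : Circ) (x : ℝ) : ℤ :=
  ∑ i ∈ Finset.range N, (⌊(L : ℝ) * (F^[i] (θ, x)).2⌋ - ⌊(L : ℝ) * (F^[i] (θ, 0)).2⌋)

theorem IsMonoLift.monotone_floor_iterate_skew (hg : IsMonoLift g) (L : ℕ) (θ : Circ) (i : ℕ) :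
    Monotone fun x => ⌊(L : ℝ) * ((skew ω b g)^[i] (θ, x)).2⌋ := fun _ _ hxy =>
  Int.floor_le_floor (mul_le_mul_of_nonneg_left ((hg.iterate_skew i θ).monotone hxy)
    (Nat.cast_nonneg L))

theorem IsMonoLift.itinerary_mem_Icc (hg : IsMonoLift g) (N L : ℕ) (θ : Circ)
    (hx : x ∈ Icc (0 : ℝ) 1) : itinerary (skew ω b g) N L θ x ∈ Finset.Icc (0 : ℤ) (N * L) := by
  have hmono (i : ℕ) := hg.monotone_floor_iterate_skew (ω := ω) (b := b) L θ i
  have hterm (i : ℕ) : ⌊(L : ℝ) * ((skew ω b g)^[i] (θ, x)).2⌋ -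
      ⌊(L : ℝ) * ((skew ω b g)^[i] (θ, 0)).2⌋ ≤ (L : ℤ) := by
    have hle := hmono i (hx.2.trans_eq (zero_add 1).symm)
    simp only [(hg.toIsDegOneLift.iterate_skew i θ).map_add_one, mul_add, mul_one,
      Int.floor_add_natCast] at hle
    linarith
  refine Finset.mem_Icc.2 ⟨Finset.sum_nonneg fun i _ => sub_nonneg.2 (hmono i hx.1), ?_⟩
  refine (Finset.sum_le_card_nsmul (Finset.range N) _ (L : ℤ) fun i _ => hterm i).trans_eq ?_
  rw [Finset.card_range, nsmul_eq_mul]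

theorem IsMonoLift.abs_iterate_skew_sub_lt_of_itinerary_eq (hg : IsMonoLift g) (hL : 0 < L)
    (h : itinerary (skew ω b g) N L θ x = itinerary (skew ω b g) N L θ y) {i : ℕ} (hi : i < N) :
    |((skew ω b g)^[i] (θ, x)).2 - ((skew ω b g)^[i] (θ, y)).2| < 1 / L := by
  wlog hxy : x ≤ y generalizing x y
  · rw [abs_sub_comm]
    exact this h.symm (le_of_not_ge hxy)
  have hterm := (Finset.sum_eq_sum_iff_of_le fun i _ => sub_le_sub_right
    (hg.monotone_floor_iterate_skew (ω := ω) (b := b) L θ i hxy) _).1 h i (Finset.mem_range.2 hi)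
  have hL' : (0 : ℝ) < L := Nat.cast_pos.2 hL
  have hfloor := Int.abs_sub_lt_one_of_floor_eq_floor (sub_left_inj.1 hterm)
  rwa [← mul_sub, abs_mul, abs_of_pos hL', ← lt_div_iff₀' hL'] at hfloor

theorem exists_forall_dist_lt_abs_iterate_skew_sub_lt (hb : Continuous b) (hg : Continuous g)
    (N : ℕ) {ε : ℝ} (hε : 0 < ε) :
    ∃ δ > 0, ∀ θ θ' : Circ, dist θ θ' < δ → ∀ i < N, ∀ x ∈ Icc (0 : ℝ) 1,
      |((skew ω b g)^[i] (θ, x)).2 - ((skew ω b g)^[i] (θ', x)).2| < ε := by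
  have hcont : Continuous fun (p : Circ × Icc (0 : ℝ) 1) (i : Fin N) =>
      ((skew ω b g)^[i] (p.1, (p.2 : ℝ))).2 :=
    continuous_pi fun i => continuous_snd.comp
      (((continuous_skew hb hg).iterate i).comp (by fun_prop))
  obtain ⟨δ, hδ, h⟩ := Metric.uniformContinuous_iff.1
    (CompactSpace.uniformContinuous_of_continuous hcont) ε hε
  refine ⟨δ, hδ, fun θ θ' hθ i hi x hx => ?_⟩
  have hdist : dist (θ, (⟨x, hx⟩ : Icc (0 : ℝ) 1)) (θ', ⟨x, hx⟩) < δ := by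
    rw [Prod.dist_eq, dist_self]
    exact max_lt hθ hδ
  exact (dist_le_pi_dist _ _ (⟨i, hi⟩ : Fin N)).trans_lt (h hdist)

theorem dist_coe_le (x y : ℝ) : dist (x : Circ) (y : Circ) ≤ |x - y| := by
  rw [dist_eq_norm, ← AddCircle.coe_sub, UnitAddCircle.norm_eq]
  simpa only [Int.cast_zero, sub_zero] using round_le (x - y) 0

theorem IsDegOneLift.proj_iterate_skew_fract (hg : IsDegOneLift g) (i : ℕ) (z : Circ × ℝ) :
    proj ((skew ω b g)^[i] (z.1, Int.fract z.2)) = proj ((skew ω b g)^[i] z) := by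
  refine (proj_eq_proj_iff.2 ⟨⌊z.2⌋, Prod.ext ?_ ?_⟩).symm
  · simp only [iterate_skew_fst]
  · simpa only [Int.fract_add_floor] using
      (hg.iterate_skew (ω := ω) (b := b) i z.1).map_add_int (Int.fract z.2) ⌊z.2⌋

/-- The itineraries of the consecutive blocks of length `N` of the orbit of `z`, computed in the
fibres over the orbit of the base point `c` instead of that of `z.1`: the set of possible values
then does not depend on `z`. -/
def blockCode (ω : Circ) (b : Circ → ℝ) (g : ℝ → ℝ) (N L : ℕ) (c : Circ) (z : Circ × ℝ)
    (m : ℕ) : ℤ :=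
  itinerary (skew ω b g) N L (c + (N * m) • ω) (Int.fract ((skew ω b g)^[N * m] z).2)

theorem IsMonoLift.dist_proj_iterate_skew_lt (hg : IsMonoLift g) (hL : 0 < L) {δ ε : ℝ}
    (hδε : 2 * δ ≤ ε) (hLε : 3 / L ≤ ε)
    (hδ : ∀ θ θ' : Circ, dist θ θ' < δ → ∀ i < N, ∀ x ∈ Icc (0 : ℝ) 1,
      |((skew ω b g)^[i] (θ, x)).2 - ((skew ω b g)^[i] (θ', x)).2| < 1 / L)
    {c : Circ} (hθ : dist θ c < δ) (hθ' : dist θ' c < δ) (hx : x ∈ Icc (0 : ℝ) 1)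
    (hy : y ∈ Icc (0 : ℝ) 1)
    (h : itinerary (skew ω b g) N L c x = itinerary (skew ω b g) N L c y) {i : ℕ} (hi : i < N) :
    dist (proj ((skew ω b g)^[i] (θ, x))) (proj ((skew ω b g)^[i] (θ', y))) < ε := by
  refine max_lt ?_ ((dist_coe_le _ _).trans_lt ?_)
  · simp only [proj, iterate_skew_fst, dist_add_right]
    linarith [dist_triangle_right θ θ' c]
  · have hxc := abs_lt.1 (hδ θ c hθ i hi x hx)
    have hyc := abs_lt.1 (hδ θ' c hθ' i hi y hy)
    have hxy := abs_lt.1 (hg.abs_iterate_skew_sub_lt_of_itinerary_eq hL h hi)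
    have hsum : (3 : ℝ) / L = 1 / L + 1 / L + 1 / L := by ring
    rw [abs_lt]
    constructor <;> linarith [hxc.1, hxc.2, hyc.1, hyc.2, hxy.1, hxy.2]

theorem IsMonoLift.dist_proj_iterate_skew_lt_of_blockCode_eq (hg : IsMonoLift g) (hL : 0 < L)
    {δ ε : ℝ} (hδε : 2 * δ ≤ ε) (hLε : 3 / L ≤ ε)
    (hδ : ∀ θ θ' : Circ, dist θ θ' < δ → ∀ i < N, ∀ x ∈ Icc (0 : ℝ) 1,
      |((skew ω b g)^[i] (θ, x)).2 - ((skew ω b g)^[i] (θ', x)).2| < 1 / L)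
    {c : Circ} {z w : Circ × ℝ} (hz : dist z.1 c < δ) (hw : dist w.1 c < δ) {k : ℕ}
    (h : ∀ m < k, blockCode ω b g N L c z m = blockCode ω b g N L c w m) {n : ℕ}
    (hn : n < N * k) :
    dist (proj ((skew ω b g)^[n] z)) (proj ((skew ω b g)^[n] w)) < ε := by
  have hN : 0 < N := Nat.pos_of_mul_pos_right (Nat.zero_lt_of_lt hn)
  have hfract (r : ℝ) : Int.fract r ∈ Icc (0 : ℝ) 1 :=
    ⟨Int.fract_nonneg r, (Int.fract_lt_one r).le⟩
  rw [← Nat.mod_add_div n N, Function.iterate_add_apply, Function.iterate_add_apply,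
    ← hg.proj_iterate_skew_fract, ← hg.proj_iterate_skew_fract _ ((skew ω b g)^[_] w)]
  refine hg.dist_proj_iterate_skew_lt hL hδε hLε hδ ?_ ?_ (hfract _) (hfract _)
    (h _ (Nat.div_lt_of_lt_mul hn)) (Nat.mod_lt n hN)
  · rwa [iterate_skew_fst, dist_add_right]
  · rwa [iterate_skew_fst, dist_add_right]

end Itinerary

section Entropy

theorem netMaxcard_le_card {X β : Type*} [PseudoMetricSpace X] {f : X → X} {M : Set X} {ε : ℝ}
    (hε : 0 < ε) {n : ℕ} {t : Finset β} {code : X → β} (hcode : MapsTo code M t)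
    (h : ∀ x ∈ M, ∀ y ∈ M, code x = code y → ∀ i < n, dist (f^[i] x) (f^[i] y) < ε) :
    Dynamics.netMaxcard f M {p | dist p.1 p.2 < ε} n ≤ t.card := by
  refine iSup₂_le fun s hs => Nat.cast_le.2 (Finset.card_le_card_of_injOn code
    (fun x hx => hcode (hs.1 hx)) fun x hx y hy hxy => ?_)
  by_contra hne
  have hdisj := Set.disjoint_left.1 (hs.2 hx hy hne)
  refine hdisj (a := y) ?_ ?_ <;> rw [Dynamics.mem_ball_dynEntourage]
  · exact h x (hs.1 hx) y (hs.1 hy) hxy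
  · exact fun i _ => (dist_self (f^[i] y)).trans_lt hε

theorem natCast_mul_netEntropyEntourage_le {X : Type*} {f : X → X} {M : Set X}
    {U : SetRel X X} {A B N : ℕ} (hN : N ≠ 0)
    (h : ∀ k, Dynamics.netMaxcard f M U (N * k) ≤ (A * B ^ k : ℕ)) :
    N * Dynamics.netEntropyEntourage f M U ≤ ENNReal.log B := by
  have hmono : Monotone fun n : ℕ => ((Dynamics.netMaxcard f M U n : ℕ∞) : ENNReal) :=
    fun m n hmn => ENat.toENNReal_mono (Dynamics.netMaxcard_monotone_time f M U hmn)
  rw [Dynamics.netEntropyEntourage, ← hmono.expGrowthSup_comp_mul hN, ← ExpGrowth.expGrowthSup_pow]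
  refine ExpGrowth.expGrowthSup_le_of_eventually_le (b := (A : ENNReal)) (by simp)
    (Eventually.of_forall fun k => ?_)
  simpa using ENat.toENNReal_mono (h k)

theorem nonpos_of_forall_natCast_mul_le_log {E : EReal} {L : ℕ}
    (h : ∀ N : ℕ, N ≠ 0 → N * E ≤ ENNReal.log (N * L + 1 : ℕ)) : E ≤ 0 := by
  by_contra! hpos
  obtain ⟨r, hr₀, hrE⟩ := EReal.lt_iff_exists_real_btwn.1 hpos
  have hr : 0 < r := EReal.coe_pos.1 hr₀
  obtain ⟨N, hN⟩ := exists_nat_gt (2 * L / r ^ 2)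
  have hN₀ : (0 : ℝ) < N := hN.trans_le' (by positivity)
  have hlog : ENNReal.log (N * L + 1 : ℕ) = (Real.log (N * L + 1) : ℝ) := by
    rw [ENNReal.log_pos_real (by simp) (ENNReal.natCast_ne_top _), ENNReal.toReal_natCast]
    push_cast
    rfl
  have hle : ((N * r : ℝ) : EReal) ≤ Real.log (N * L + 1) := by
    rw [← hlog, EReal.coe_mul]
    exact (mul_le_mul_of_nonneg_left hrE.le (by positivity)).trans (h N (Nat.cast_pos.1 hN₀).ne')
  have hexp : Real.exp (N * r) ≤ N * L + 1 :=
    (Real.le_log_iff_exp_le (by positivity)).1 (EReal.coe_le_coe_iff.1 hle)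
  have hquad := Real.quadratic_le_exp_of_nonneg (mul_pos hN₀ hr).le
  rw [div_lt_iff₀ (by positivity)] at hN
  nlinarith [mul_pos hN₀ hr, mul_lt_mul_of_pos_left hN hN₀]

variable {ω : Circ} {b : Circ → ℝ} {g : ℝ → ℝ} {f : Circ × Circ → Circ × Circ}
  {M : Set (Circ × Circ)}

theorem IsMonoLift.exists_netMaxcard_le (hg : IsMonoLift g) (hb : Continuous b)
    (hf : ∀ z, proj z ∈ M → ∀ n, f^[n] (proj z) = proj ((skew ω b g)^[n] z)) {L : ℕ} (hL : 0 < L)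
    {ε : ℝ} (hε : 0 < ε) (hLε : 3 / L ≤ ε) (N : ℕ) :
    ∃ A : ℕ, ∀ k, Dynamics.netMaxcard f M {p | dist p.1 p.2 < ε} (N * k) ≤
      (A * (N * L + 1) ^ k : ℕ) := by
  have hL' : (0 : ℝ) < 1 / L := by positivity
  obtain ⟨δ₀, hδ₀, hclose₀⟩ :=
    exists_forall_dist_lt_abs_iterate_skew_sub_lt (ω := ω) hb hg.continuous N hL'
  obtain ⟨δ, hδ, hδδ₀, hδε⟩ : ∃ δ > 0, δ ≤ δ₀ ∧ 2 * δ ≤ ε :=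
    ⟨min δ₀ (ε / 2), by positivity, min_le_left _ _, by linarith [min_le_right δ₀ (ε / 2)]⟩
  have hclose (θ θ' : Circ) (h : dist θ θ' < δ) := hclose₀ θ θ' (h.trans_le hδδ₀)
  obtain ⟨J, -, hJ⟩ := isCompact_univ.elim_nhds_subcover (fun c : Circ => Metric.ball c δ)
    fun c _ => Metric.ball_mem_nhds c hδ
  have hJ' (z : Circ × ℝ) : ∃ c ∈ J, dist z.1 c < δ := by
    simpa only [mem_iUnion₂, Metric.mem_ball, exists_prop] using hJ (mem_univ z.1)
  choose c hcJ hc using hJ'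
  obtain ⟨lift, hlift⟩ := isOpenQuotientMap_proj.surjective.hasRightInverse
  have hcode (k : ℕ) : MapsTo (fun w => (c (lift w), fun m : Fin k =>
      blockCode ω b g N L (c (lift w)) (lift w) m)) M
      (J ×ˢ Fintype.piFinset fun _ : Fin k => Finset.Icc (0 : ℤ) (N * L) : Finset _) :=
    fun w _ => Finset.mem_product.2 ⟨hcJ _, Fintype.mem_piFinset.2 fun m =>
      hg.itinerary_mem_Icc N L _ ⟨Int.fract_nonneg _, (Int.fract_lt_one _).le⟩⟩
  refine ⟨J.card, fun k => (netMaxcard_le_card hε (hcode k) fun v hv w hw hvw n hn => ?_).trans_eq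
    ?_⟩
  · obtain ⟨hcvw, hblock⟩ := Prod.mk.inj hvw
    have horbit (u : Circ × Circ) (hu : u ∈ M) := hf (lift u) (by rwa [hlift]) n
    simp only [hlift _] at horbit
    rw [horbit v hv, horbit w hw]
    refine hg.dist_proj_iterate_skew_lt_of_blockCode_eq hL hδε hLε hclose (hc (lift v))
      (hcvw ▸ hc (lift w)) (fun m hm => ?_) hn
    rw [congrFun hblock ⟨m, hm⟩, hcvw]
  · have hcard : (Finset.Icc (0 : ℤ) (N * L)).card = N * L + 1 := by
      rw [Int.card_Icc, sub_zero]
      exact_mod_cast Int.toNat_natCast (N * L + 1)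
    rw [Finset.card_product, Fintype.card_piFinset_const, hcard, Nat.cast_mul]

theorem IsMonoLift.zeroEntropyOn (hg : IsMonoLift g) (hb : Continuous b) (hne : M.Nonempty)
    (hM : MapsTo f M M)
    (hf : ∀ z, proj z ∈ M → ∀ n, f^[n] (proj z) = proj ((skew ω b g)^[n] z)) :
    ZeroEntropyOn f M := by
  refine ⟨hM, ?_⟩
  rw [Dynamics.coverEntropy_restrict]
  refine le_antisymm ?_ (Dynamics.coverEntropy_nonneg f hne)
  rw [Dynamics.coverEntropy_eq_iSup_basis_netEntropyEntourage Metric.uniformity_basis_dist]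
  refine iSup₂_le fun ε hε => ?_
  obtain ⟨L, hL⟩ := exists_nat_gt (3 / ε)
  have hL₀ : (0 : ℝ) < L := hL.trans' (by positivity)
  have hLε : 3 / (L : ℝ) ≤ ε := ((div_lt_comm₀ hε hL₀).1 hL).le
  refine nonpos_of_forall_natCast_mul_le_log (L := L) fun N hN => ?_
  obtain ⟨A, hA⟩ := hg.exists_netMaxcard_le hb hf (Nat.cast_pos.1 hL₀) hε hLε N
  exact natCast_mul_netEntropyEntourage_le hN hA

end Entropy

section Dispersed

theorem exists_iterate_mem_of_isMinimalSet {X : Type*} [TopologicalSpace X] {f : X → X}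
    {M U : Set X} (hM : IsMinimalSet f M) (hf : Continuous f) (hU : IsOpen U)
    (hUM : (U ∩ M).Nonempty) {x : X} (hx : x ∈ M) : ∃ n, f^[n] x ∈ U := by
  by_contra! hcon
  obtain ⟨z, hzU, hzM⟩ := hUM
  have hM' := hM.eq_of_subset (M ∩ ⋂ n, f^[n] ⁻¹' Uᶜ) inter_subset_left ⟨x, hx, mem_iInter.2 hcon⟩
    (hM.isClosed.inter (isClosed_iInter fun n => hU.isClosed_compl.preimage (hf.iterate n)))
    fun y hy => ⟨hM.mapsTo hy.1, mem_iInter.2 fun n => mem_iInter.1 hy.2 (n + 1)⟩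
  exact mem_iInter.1 (hM'.symm.subset hzM).2 0 hzU

variable {f : Circ × Circ → Circ × Circ} {ω : Circ} {M : Set (Circ × Circ)}

theorem iterate_fst (hfω : ∀ w, (f w).1 = w.1 + ω) (n : ℕ) (w : Circ × Circ) :
    (f^[n] w).1 = w.1 + n • ω := by
  have hsemi : Function.Semiconj Prod.fst f (· + ω) := hfω
  rw [(hsemi.iterate_right n).eq, add_right_iterate]

theorem fst_image_eq_univ_of_isMinimalSet (hM : IsMinimalSet f M) (hfω : ∀ w, (f w).1 = w.1 + ω)
    (hω : DenseRange fun n : ℕ => n • ω) : Prod.fst '' M = univ := by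
  have hcl : IsClosed (Prod.fst '' M) := (hM.isClosed.isCompact.image continuous_fst).isClosed
  obtain ⟨w, hw⟩ := hM.nonempty
  have horbit : DenseRange fun n : ℕ => w.1 + n • ω :=
    (Homeomorph.addLeft w.1).surjective.denseRange.comp hω (Homeomorph.addLeft w.1).continuous
  rw [← hcl.closure_eq]
  refine (horbit.mono ?_).closure_eq
  rintro _ ⟨n, rfl⟩
  exact ⟨f^[n] w, hM.mapsTo.iterate n hw, iterate_fst hfω n w⟩

/-- Countably many rotations of the projection cover the circle, so Baire's theorem applies. -/
theorem nonempty_interior_fst_image_of_isMinimalSet (hM : IsMinimalSet f M) (hf : Continuous f)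
    (hfω : ∀ w, (f w).1 = w.1 + ω) (hω : DenseRange fun n : ℕ => n • ω)
    {V : Set (Circ × Circ)} (hV : IsClosed V) (hVM : (interior V ∩ M).Nonempty) :
    (interior (Prod.fst '' (V ∩ M))).Nonempty := by
  have hcl : IsClosed (Prod.fst '' (V ∩ M)) :=
    ((hV.inter hM.isClosed).isCompact.image continuous_fst).isClosed
  have hcover : ⋃ n : ℕ, Homeomorph.addRight (n • ω) ⁻¹' (Prod.fst '' (V ∩ M)) = univ := by
    refine eq_univ_of_forall fun θ => ?_
    obtain ⟨w, hw, rfl⟩ := (fst_image_eq_univ_of_isMinimalSet hM hfω hω).symm.subset (mem_univ θ)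
    obtain ⟨n, hn⟩ := exists_iterate_mem_of_isMinimalSet hM hf isOpen_interior hVM hw
    exact mem_iUnion.2
      ⟨n, f^[n] w, ⟨interior_subset hn, hM.mapsTo.iterate n hw⟩, iterate_fst hfω n w⟩
  obtain ⟨n, hn⟩ := nonempty_interior_of_iUnion_of_closed
    (fun n => hcl.preimage (Homeomorph.continuous _)) hcover
  rw [← Homeomorph.preimage_interior] at hn
  exact hn.elim fun θ hθ => ⟨_, hθ⟩

theorem exists_coe_image_Ioo_subset {A : Set Circ} (hA : (interior A).Nonempty) :
    ∃ a b : ℝ, a < b ∧ (fun t : ℝ => (t : Circ)) '' Ioo a b ⊆ A := by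
  obtain ⟨t, ht⟩ := hA.preimage QuotientAddGroup.mk_surjective
  obtain ⟨a, b, hab, hsub⟩ :=
    (isOpen_interior.preimage (AddCircle.continuous_mk' 1)).exists_Ioo_subset ⟨t, ht⟩
  exact ⟨a, b, hab, image_subset_iff.2 (hsub.trans (preimage_mono interior_subset))⟩

theorem exists_coe_image_Ioo_subset_of_isMinimalSet (hM : IsMinimalSet f M) (hf : Continuous f)
    (hfω : ∀ w, (f w).1 = w.1 + ω) (hω : DenseRange fun n : ℕ => n • ω) {z : Circ × Circ}
    (hz : z ∈ M) {U : Set (Circ × Circ)} (hU : IsOpen U) (hzU : z ∈ U) :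
    ∃ a b : ℝ, a < b ∧ (fun t : ℝ => (t : Circ)) '' Ioo a b ⊆ Prod.fst '' (U ∩ M) := by
  obtain ⟨V, hV, hVcl, hVU⟩ := exists_mem_nhds_isClosed_subset (hU.mem_nhds hzU)
  obtain ⟨a, b, hab, hsub⟩ := exists_coe_image_Ioo_subset
    (nonempty_interior_fst_image_of_isMinimalSet hM hf hfω hω hVcl
      ⟨z, mem_interior_iff_mem_nhds.2 hV, hz⟩)
  exact ⟨a, b, hab, hsub.trans (image_mono (inter_subset_inter_left M hVU))⟩

end Dispersed

section Components

variable {Y : Type*} [TopologicalSpace Y]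

theorem exists_isClopen_of_connectedComponent_subset [CompactSpace Y] [T2Space Y] {y : Y}
    {O : Set Y} (hO : IsOpen O) (h : connectedComponent y ⊆ O) :
    ∃ W : Set Y, IsClopen W ∧ y ∈ W ∧ W ⊆ O := by
  rw [connectedComponent_eq_iInter_isClopen] at h
  have : Nonempty {s : Set Y // IsClopen s ∧ y ∈ s} := ⟨⟨univ, isClopen_univ, mem_univ y⟩⟩
  obtain ⟨⟨W, hW, hyW⟩, hWO⟩ := exists_subset_nhds_of_isCompact
    (V := fun s : {s : Set Y // IsClopen s ∧ y ∈ s} => (s : Set Y))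
    (fun s t => ⟨⟨s ∩ t, s.2.1.inter t.2.1, s.2.2, t.2.2⟩, inter_subset_left, inter_subset_right⟩)
    (fun s => s.2.1.isClosed.isCompact) (U := O) fun x hx => hO.mem_nhds (h hx)
  exact ⟨W, hW, hyW, hWO⟩

theorem eq_of_isPreconnected_of_coe_eq {S : Set Y} (hS : IsPreconnected S) {h : Y → ℝ}
    (hh : ContinuousOn h S) {c : Circ} (hc : ∀ y ∈ S, (h y : Circ) = c) {x y : Y} (hx : x ∈ S)
    (hy : y ∈ S) : h x = h y := by
  have hint : MapsTo (fun w => h w - h x) S (range ((↑) : ℤ → ℝ)) := fun w hw => by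
    obtain ⟨k, hk⟩ := (AddCircle.coe_eq_zero_iff 1).1
      (show ((h w - h x : ℝ) : Circ) = 0 by rw [AddCircle.coe_sub, hc w hw, hc x hx, sub_self])
    exact ⟨k, by simpa using hk⟩
  exact (sub_left_inj.1 (hS.constant_of_mapsTo
    Int.isClosedEmbedding_coe_real.isEmbedding.isInducing.isDiscrete_range
    (hh.sub continuousOn_const) hint hx hy))

theorem lt_add_one_of_isPreconnected_of_coe_ne {S : Set Y} (hS : IsPreconnected S) {h : Y → ℝ}
    (hh : ContinuousOn h S) {c : Circ} (hc : ∀ y ∈ S, (h y : Circ) ≠ c) {x y : Y} (hx : x ∈ S)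
    (hy : y ∈ S) : h y < h x + 1 := by
  by_contra! hle
  obtain ⟨t, ht, rfl⟩ : c ∈ (fun t : ℝ => (t : Circ)) '' Ico (h x) (h x + 1) :=
    (AddCircle.coe_image_Ico_eq 1 (h x)).symm.subset (mem_univ c)
  obtain ⟨w, hw, rfl⟩ := hS.intermediate_value hx hy hh ⟨ht.1, ht.2.le.trans hle⟩
  exact hc w hw rfl

theorem exists_continuousOn_lift_union {q : Y → Circ} {W W' : Set Y} (hW : IsClopen W)
    (hW' : IsOpen W') (h : ∃ p : Y → ℝ, ContinuousOn p W ∧ ∀ y ∈ W, (p y : Circ) = q y)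
    (h' : ∃ p : Y → ℝ, ContinuousOn p W' ∧ ∀ y ∈ W', (p y : Circ) = q y) :
    ∃ p : Y → ℝ, ContinuousOn p (W ∪ W') ∧ ∀ y ∈ W ∪ W', (p y : Circ) = q y := by
  classical
  obtain ⟨p, hp, hpq⟩ := h
  obtain ⟨p', hp', hpq'⟩ := h'
  have heq : EqOn (W.piecewise p p') p W := piecewise_eqOn W p p'
  have heq' : EqOn (W.piecewise p p') p' (W' \ W) :=
    (piecewise_eqOn_compl W p p').mono fun _ hy => hy.2
  rw [← union_sdiff_self]
  refine ⟨W.piecewise p p', (hp.congr heq).union_of_isOpen ((hp'.mono sdiff_subset).congr heq')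
    hW.isOpen (hW'.sdiff hW.isClosed), ?_⟩
  rintro y (hy | hy)
  · rw [heq hy, hpq y hy]
  · rw [heq' hy, hpq' y hy.1]

theorem exists_continuous_lift [CompactSpace Y] [T2Space Y] {q : Y → Circ} (hq : Continuous q)
    (hne : ∀ y, q '' connectedComponent y ≠ univ) :
    ∃ p : Y → ℝ, Continuous p ∧ ∀ y, (p y : Circ) = q y := by
  obtain ⟨W, -, hW, p, hp, hpq⟩ : ∃ W, IsClopen W ∧ univ ⊆ W ∧ ∃ p : Y → ℝ,
      ContinuousOn p W ∧ ∀ y ∈ W, (p y : Circ) = q y := by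
    refine isCompact_univ.induction_on (p := fun s => ∃ W, IsClopen W ∧ s ⊆ W ∧ ∃ p : Y → ℝ,
      ContinuousOn p W ∧ ∀ y ∈ W, (p y : Circ) = q y) ?_ ?_ ?_ ?_
    · exact ⟨∅, isClopen_empty, Subset.rfl, fun _ => 0, continuousOn_empty _, fun _ => False.elim⟩
    · rintro s t hst ⟨W, hW, htW, h⟩
      exact ⟨W, hW, hst.trans htW, h⟩
    · rintro s t ⟨W, hW, hsW, h⟩ ⟨W', hW', htW', h'⟩
      exact ⟨W ∪ W', hW.union hW', union_subset_union hsW htW',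
        exists_continuousOn_lift_union hW hW'.isOpen h h'⟩
    · intro y _
      obtain ⟨θ, hθ⟩ := (ne_univ_iff_exists_notMem _).1 (hne y)
      obtain ⟨a, rfl⟩ := QuotientAddGroup.mk_surjective θ
      obtain ⟨W, hW, hyW, hWO⟩ := exists_isClopen_of_connectedComponent_subset
        (isOpen_compl_singleton.preimage hq : IsOpen (q ⁻¹' {(a : Circ)}ᶜ))
        fun x hx hxa => hθ ⟨x, hx, hxa⟩
      exact ⟨W, mem_nhdsWithin_of_mem_nhds (hW.isOpen.mem_nhds hyW), W, hW, Subset.rfl,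
        fun x => AddCircle.equivIco 1 a (q x), fun x hx => (continuous_subtype_val.continuousAt.comp
          ((AddCircle.continuousAt_equivIco 1 a (hWO hx)).comp hq.continuousAt)).continuousWithinAt,
        fun x _ => AddCircle.coe_equivIco⟩
  exact ⟨p, continuousOn_univ.1 (hp.mono hW), fun y => hpq y (hW (mem_univ y))⟩

/-- The infimum of a function over the connected component of a point. -/
def compInf (p : Y → ℝ) (y : Y) : ℝ := sInf (p '' connectedComponent y)

section CompInf

variable {p : Y → ℝ} {x y : Y}

theorem compInf_eq_of_mem (hx : x ∈ connectedComponent y) : compInf p x = compInf p y := by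
  rw [compInf, compInf, connectedComponent_eq hx]

variable [CompactSpace Y]

theorem compInf_le (hp : Continuous p) (hx : x ∈ connectedComponent y) : compInf p y ≤ p x :=
  csInf_le (isClosed_connectedComponent.isCompact.image hp).bddBelow (mem_image_of_mem p hx)

theorem exists_compInf_eq (hp : Continuous p) (y : Y) :
    ∃ x ∈ connectedComponent y, compInf p y = p x :=
  isClosed_connectedComponent.isCompact.exists_sInf_image_eq ⟨y, mem_connectedComponent⟩
    hp.continuousOn

theorem lowerSemicontinuous_compInf [T2Space Y] (hp : Continuous p) :
    LowerSemicontinuous (compInf p) := by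
  intro y c hc
  obtain ⟨W, hW, hyW, hWc⟩ := exists_isClopen_of_connectedComponent_subset
    (isOpen_Ioi.preimage hp : IsOpen (p ⁻¹' Ioi c)) fun x hx => hc.trans_le (compInf_le hp hx)
  filter_upwards [hW.isOpen.mem_nhds hyW] with z hz
  obtain ⟨x, hx, hxz⟩ := exists_compInf_eq hp z
  exact hxz ▸ hWc (hW.connectedComponent_subset hz hx)

/-- The height `p y - compInf p y` of a point above the bottom of its component is upper
semicontinuous and does not decrease along orbits, so by minimality it is constant. It vanishes
where the infimum is attained. -/
theorem eq_of_mem_connectedComponent [T2Space Y] {φ : Y → Y} (hφ : Continuous φ)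
    (hmin : IsMinimalSet φ univ) (hp : Continuous p)
    (hpφ : ∀ y, ∀ x ∈ connectedComponent y, p (φ x) - p x = p (φ y) - p y)
    (hx : x ∈ connectedComponent y) : p x = p y := by
  have hinv (z : Y) : compInf p (φ z) - p (φ z) ≤ compInf p z - p z := by
    obtain ⟨v, hv, hvz⟩ := exists_compInf_eq hp z
    linarith [hpφ z v hv, compInf_le hp (hφ.mapsTo_connectedComponent z hv)]
  have hle (y z : Y) : compInf p z - p z ≤ compInf p y - p y := by
    have hlsc : LowerSemicontinuous fun z => compInf p z + -p z :=
      (lowerSemicontinuous_compInf hp).add hp.neg.lowerSemicontinuous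
    have huniv := hmin.eq_of_subset {z | compInf p z - p z ≤ compInf p y - p y} (subset_univ _)
      ⟨y, le_refl (compInf p y - p y)⟩ (hlsc.isClosed_preimage _) fun z hz => (hinv z).trans hz
    exact huniv.symm.subset (mem_univ z)
  have hzero (z : Y) : p z = compInf p z := by
    obtain ⟨v, hv, hvz⟩ := exists_compInf_eq hp z
    linarith [hle z v, compInf_eq_of_mem (p := p) hv,
      compInf_le hp (mem_connectedComponent (x := z))]
  rw [hzero x, hzero y, compInf_eq_of_mem hx]

end CompInf

theorem isMinimalSet_restrict {f : Y → Y} {M : Set Y} (hM : IsMinimalSet f M) :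
    IsMinimalSet (hM.mapsTo.restrict f M M) univ where
  nonempty := have := hM.nonempty.to_subtype; univ_nonempty
  isClosed := isClosed_univ
  mapsTo := mapsTo_univ _ _
  eq_of_subset N _ hne hcl hN := by
    have hNM := hM.eq_of_subset (Subtype.val '' N) (Subtype.coe_image_subset M N)
      (hne.image _) (hM.isClosed.isClosedEmbedding_subtypeVal.isClosedMap N hcl) <| by
        rintro _ ⟨w, hw, rfl⟩
        exact ⟨_, hN hw, rfl⟩
    rw [← image_val_inj, hNM, image_univ, Subtype.range_coe]

theorem eq_of_mem_connectedComponent_of_rotation [CompactSpace Y] [T2Space Y] {φ : Y → Y}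
    (hφ : Continuous φ) (hmin : IsMinimalSet φ univ) {q : Y → Circ} (hq : Continuous q) {ω : Circ}
    (hqφ : ∀ y, q (φ y) = q y + ω) (hne : ∀ y, q '' connectedComponent y ≠ univ) {x y : Y}
    (hx : x ∈ connectedComponent y) : q x = q y := by
  obtain ⟨p, hp, hpq⟩ := exists_continuous_lift hq hne
  have hstep (z : Y) : ((p (φ z) - p z : ℝ) : Circ) = ω := by
    rw [AddCircle.coe_sub, hpq, hpq, hqφ, add_sub_cancel_left]
  have hpφ (y x : Y) (hx : x ∈ connectedComponent y) : p (φ x) - p x = p (φ y) - p y :=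
    eq_of_isPreconnected_of_coe_eq isPreconnected_connectedComponent
      (((hp.comp hφ).sub hp).continuousOn) (fun z _ => hstep z) hx mem_connectedComponent
  rw [← hpq, ← hpq, eq_of_mem_connectedComponent hφ hmin hp hpφ hx]

theorem exists_fst_image_connectedComponentIn_eq {ω : Circ}
    {f : Circ × Circ → Circ × Circ} {M : Set (Circ × Circ)} (hM : IsMinimalSet f M)
    (hf : Continuous f) (hfω : ∀ w, (f w).1 = w.1 + ω)
    (hne : ∀ C ⊆ M, IsPreconnected C → Prod.fst '' C ≠ univ) {z : Circ × Circ} (hz : z ∈ M) :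
    ∃ θ, Prod.fst '' connectedComponentIn M z = {θ} := by
  have : CompactSpace M := isCompact_iff_compactSpace.1 hM.isClosed.isCompact
  have hne' (y : M) : (fun w : M => w.1.1) '' connectedComponent y ≠ univ := by
    rw [← image_image Prod.fst Subtype.val]
    exact hne _ (Subtype.coe_image_subset M _)
      (isPreconnected_connectedComponent.image _ continuous_subtype_val.continuousOn)
  refine ⟨z.1, Subset.antisymm ?_
    (singleton_subset_iff.2 (mem_image_of_mem _ (mem_connectedComponentIn hz)))⟩
  rw [connectedComponentIn_eq_image hz]
  rintro _ ⟨_, ⟨x, hx, rfl⟩, rfl⟩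
  exact eq_of_mem_connectedComponent_of_rotation (hf.restrict hM.mapsTo) (isMinimalSet_restrict hM)
    (continuous_fst.comp continuous_subtype_val) (fun w => hfω w) hne' hx

end Components

section Forcing

variable {ω : Circ} {b : Circ → ℝ} {g : ℝ → ℝ} {M C : Set (Circ × Circ)}

/-- A connected set avoiding the plateaus of `g` has fibre coordinate in an interval of length one,
and so has its image. As `g` is monotone, this limits the oscillation of the forcing. -/
theorem IsMonoLift.forcing_lt_add_two (hg : IsMonoLift g) (hb : Continuous b)
    (hv : (plateau g).Nonempty) (hM : proj ⁻¹' M ⊆ avoidSet ω b g) (hCM : C ⊆ M)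
    (hC : IsPreconnected C) {w w' : Circ × Circ} (hw : w ∈ C) (hw' : w' ∈ C) :
    b w.1 < b w'.1 + 2 := by
  obtain ⟨v, hv⟩ := hv
  have hplateau {x : ℝ} (hx : x ∉ plateau g) : (x : Circ) ≠ v := fun hxv => hx <| by
    obtain ⟨k, hk⟩ := proj_eq_proj_iff.1 (show proj (0, x) = proj (0, v) from Prod.ext rfl hxv)
    obtain rfl : x = v + k := (Prod.ext_iff.1 hk).2
    exact hg.add_int_mem_plateau_iff.2 hv
  let s (φ : Circ) : ℝ := AddCircle.equivIco 1 v φ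
  have hs (φ : Circ) : s φ ∈ Ico v (v + 1) := (AddCircle.equivIco 1 v φ).2
  have havoid (u : Circ × Circ) (hu : u ∈ C) : (u.1, s u.2) ∈ avoidSet ω b g := hM <| by
    rw [mem_preimage, proj, AddCircle.coe_equivIco]
    exact hCM hu
  have hscont : ContinuousOn (fun u : Circ × Circ => s u.2) C := fun u hu => by
    have huv : u.2 ≠ v := fun h => hplateau (havoid u hu 0) (AddCircle.coe_equivIco.trans h)
    exact (continuous_subtype_val.continuousAt.comp
      ((AddCircle.continuousAt_equivIco 1 v huv).comp continuousAt_snd)).continuousWithinAt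
  have himage := lt_add_one_of_isPreconnected_of_coe_ne hC
    (h := fun u => g (s u.2) + b u.1) ((hg.continuous.comp_continuousOn hscont).add
      (hb.comp continuous_fst).continuousOn)
    (fun u hu => hplateau (skew_mem_avoidSet (havoid u hu) 0)) hw' hw
  have hgs : g (s w'.2) ≤ g (s w.2) + 1 := by
    rw [← hg.map_add_one]
    exact hg.monotone (by linarith [(hs w'.2).2, (hs w.2).1])
  linarith

theorem IsMonoLift.fst_image_ne_univ (hg : IsMonoLift g) (hb : Continuous b)
    (hosc : ∃ θ θ', b θ' + 2 ≤ b θ) (hv : (plateau g).Nonempty)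
    (hM : proj ⁻¹' M ⊆ avoidSet ω b g) (hCM : C ⊆ M) (hC : IsPreconnected C) :
    Prod.fst '' C ≠ univ := by
  intro hfull
  obtain ⟨θ, θ', hθ⟩ := hosc
  obtain ⟨w, hw, rfl⟩ := hfull.symm.subset (mem_univ θ)
  obtain ⟨w', hw', rfl⟩ := hfull.symm.subset (mem_univ θ')
  exact hθ.not_gt (hg.forcing_lt_add_two hb hv hM hCM hC hw hw')

end Forcing

section SkewProduct

variable {ω : Circ} {b : Circ → ℝ} {g G : ℝ → ℝ} {f : Circ × Circ → Circ × Circ} {ρ : ℝ}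

theorem plateau_nonempty_of_not_monotone (hg : Monotone g) (hgG : ∀ x ∉ plateau g, g x = G x)
    (hG : ¬ Monotone G) : (plateau g).Nonempty := by
  by_contra! hempty
  refine hG ?_
  rwa [← funext fun x => hgG x (hempty ▸ notMem_empty x)]

theorem iterate_proj_eq_of_mem_avoidSet (hf : IsLift f (skew ω b G))
    (hgG : ∀ x ∉ plateau g, g x = G x) {z : Circ × ℝ} (hz : z ∈ avoidSet ω b g) (n : ℕ) :
    f^[n] (proj z) = proj ((skew ω b g)^[n] z) := by
  have hsemi : Function.Semiconj proj (skew ω b G) f := hf.semiconj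
  rw [← (hsemi.iterate_right n).eq, iterate_skew_eq_of_mem_avoidSet hgG hz]

theorem IsMonoLift.isStrangelyDispersed (hg : IsMonoLift g) (hv : (plateau g).Nonempty)
    (hb : Continuous b) (hosc : ∃ θ θ', b θ' + 2 ≤ b θ) (hω : DenseRange fun n : ℕ => n • ω)
    (hf : Continuous f) (hfω : ∀ w, (f w).1 = w.1 + ω) {M : Set (Circ × Circ)}
    (hM : IsMinimalSet f M) (havoid : proj ⁻¹' M ⊆ avoidSet ω b g) :
    IsStrangelyDispersed f M where
  isCompact := hM.isClosed.isCompact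
  minimal := hM
  component _ hz := exists_fst_image_connectedComponentIn_eq hM hf hfω
    (fun _ hCM hC => hg.fst_image_ne_univ hb hosc hv havoid hCM hC) hz
  dispersed _ hz _ hU hzU :=
    exists_coe_image_Ioo_subset_of_isMinimalSet hM hf hfω hω hz hU hzU

theorem IsDegOneLift.exists_isStrangelyDispersed (hG : IsDegOneLift G) (hmono : ¬ Monotone G)
    (hb : Continuous b) (hosc : ∃ θ θ', b θ' + 2 ≤ b θ) (hω : DenseRange fun n : ℕ => n • ω)
    (hf : IsLift f (skew ω b G)) (hρ : ρ ∈ fibRot (skew ω b G)) :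
    ∃ M, IsStrangelyDispersed f M ∧ HasUniformRotation (skew ω b G) M ρ ∧ ZeroEntropyOn f M := by
  rw [hG.fibRot_skew_eq_Icc hb hω] at hρ
  obtain ⟨g, hg, hgG, rfl⟩ := hG.exists_isMonoLift_fibRotNum_eq hb hω hρ
  obtain ⟨M, hM, havoid, hrot⟩ := hg.exists_isMinimalSet_hasUniformRotation hgG hb hω hf
  have hv := plateau_nonempty_of_not_monotone hg.monotone hgG hmono
  exact ⟨M, hg.isStrangelyDispersed hv hb hosc hω (continuous_of_isLift hf)
      (fst_apply_of_isLift hf) hM havoid, hrot,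
    hg.zeroEntropyOn hb hM.nonempty hM.mapsTo fun _ hz n =>
      iterate_proj_eq_of_mem_avoidSet hf hgG (havoid hz) n⟩

end SkewProduct

theorem disjoint_of_hasUniformRotation {F : Circ × ℝ → Circ × ℝ} {M M' : Set (Circ × Circ)}
    {ρ ρ' : ℝ} (h : HasUniformRotation F M ρ) (h' : HasUniformRotation F M' ρ') (hne : ρ ≠ ρ') :
    Disjoint M M' := by
  refine Set.disjoint_left.2 fun w hw hw' => ?_
  obtain ⟨z, rfl⟩ := isOpenQuotientMap_proj.surjective w
  exact hne (tendsto_nhds_unique (h.tendsto_at hw) (h'.tendsto_at hw'))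

theorem not_countable_image_of_pairwiseDisjoint {ι X : Type*} {s : Set ι} {M : ι → Set X}
    (hs : ¬ s.Countable) (hM : s.PairwiseDisjoint M) (hne : ∀ i ∈ s, (M i).Nonempty) :
    ¬ (M '' s).Countable := fun hcount => by
  have hinj : InjOn M s := fun i hi j hj hij => hM.elim hi hj fun hdisj =>
    (hne j hj).ne_empty (disjoint_self.1 (hij ▸ hdisj))
  exact hs (countable_of_injective_of_countable_image hinj hcount)

theorem exists_int_add_eq_of_isLift {f : Circ × Circ → Circ × Circ} {F F' : Circ × ℝ → Circ × ℝ}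
    (hF : IsLift f F) (hF' : IsLift f F') : ∃ k : ℤ, ∀ z, F z = ((F' z).1, (F' z).2 + k) := by
  have hproj (z : Circ × ℝ) : proj (F z) = proj (F' z) := by rw [hF.semiconj, hF'.semiconj]
  have hzero (z : Circ × ℝ) : (((F z).2 - (F' z).2 : ℝ) : Circ) = 0 := by
    rw [AddCircle.coe_sub, sub_eq_zero]
    exact (Prod.ext_iff.1 (hproj z)).2
  obtain ⟨k, hk⟩ := (AddCircle.coe_eq_zero_iff 1).1 (hzero 0)
  refine ⟨k, fun z => Prod.ext (Prod.ext_iff.1 (hproj z)).1 ?_⟩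
  have hconst : (F z).2 - (F' z).2 = (F 0).2 - (F' 0).2 := eq_of_isPreconnected_of_coe_eq
    isPreconnected_univ (hF.continuous.snd.sub hF'.continuous.snd).continuousOn
    (fun z _ => hzero z) (mem_univ z) (mem_univ 0)
  rw [zsmul_one] at hk
  linarith

theorem sin_two_pi_mul_add_half (x : ℝ) :
    Real.sin (2 * Real.pi * (x + 1 / 2)) = -Real.sin (2 * Real.pi * x) := by
  rw [show 2 * Real.pi * (x + 1 / 2) = 2 * Real.pi * x + Real.pi by ring, Real.sin_add_pi]

theorem exists_mul_sin_two_pi_mul_eq_abs (c : ℝ) : ∃ x, c * Real.sin (2 * Real.pi * x) = |c| := by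
  have hquarter : Real.sin (2 * Real.pi * (1 / 4)) = 1 := by
    rw [show 2 * Real.pi * (1 / 4) = Real.pi / 2 by ring, Real.sin_pi_div_two]
  rcases le_total 0 c with hc | hc
  · exact ⟨1 / 4, by rw [hquarter, mul_one, abs_of_nonneg hc]⟩
  · exact ⟨1 / 4 + 1 / 2, by
      rw [sin_two_pi_mul_add_half, hquarter, mul_neg_one, abs_of_nonpos hc]⟩

theorem exists_mul_sinCirc_add_two_le {β : ℝ} (hβ : 1 ≤ |β|) :
    ∃ θ θ', β * sinCirc θ' + 2 ≤ β * sinCirc θ := by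
  obtain ⟨x, hx⟩ := exists_mul_sin_two_pi_mul_eq_abs β
  refine ⟨x, ((x + 1 / 2 : ℝ) : Circ), ?_⟩
  change β * Real.sin (2 * Real.pi * (x + 1 / 2)) + 2 ≤ β * Real.sin (2 * Real.pi * x)
  rw [sin_two_pi_mul_add_half, mul_neg, hx]
  linarith

/-- A lift of the unforced Arnold circle map. -/
def arnoldFibre (τ α x : ℝ) : ℝ := x + τ + α / (2 * Real.pi) * Real.sin (2 * Real.pi * x)

section ArnoldFibre

variable (τ : ℝ) {α : ℝ}

theorem isDegOneLift_arnoldFibre (α : ℝ) : IsDegOneLift (arnoldFibre τ α) where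
  continuous := by
    unfold arnoldFibre
    fun_prop
  map_add_one x := by
    have hsin : Real.sin (2 * Real.pi * (x + 1)) = Real.sin (2 * Real.pi * x) :=
      sin_two_pi_periodic x
    rw [arnoldFibre, arnoldFibre, hsin]
    ring

theorem hasDerivAt_arnoldFibre (α x : ℝ) :
    HasDerivAt (arnoldFibre τ α) (1 + α * Real.cos (2 * Real.pi * x)) x := by
  refine (((hasDerivAt_id x).add_const τ).add
    ((hasDerivAt_const_mul (2 * Real.pi)).sin.const_mul (α / (2 * Real.pi)))).congr_deriv ?_
  field_simp

theorem not_monotone_arnoldFibre (hα : 1 < |α|) : ¬ Monotone (arnoldFibre τ α) := fun hmono => by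
  have hnonneg (x : ℝ) : 0 ≤ 1 + α * Real.cos (2 * Real.pi * x) :=
    (hasDerivAt_arnoldFibre τ α x).deriv ▸ hmono.deriv_nonneg
  have h₀ := hnonneg 0
  have h₁ := hnonneg (1 / 2)
  rw [mul_zero, Real.cos_zero] at h₀
  rw [mul_one_div, mul_div_cancel_left₀ _ two_ne_zero, Real.cos_pi] at h₁
  exact hα.not_ge (abs_le.2 ⟨by linarith, by linarith⟩)

theorem IsDegOneLift.runInf_add_le_runSup {H : ℝ → ℝ} (hH : IsDegOneLift H) {y z c : ℝ}
    (hyz : y + 1 ≤ z) (hc : H z + c ≤ H y) (x : ℝ) : runInf H x + c ≤ runSup H x := by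
  have hinf : runInf H x ≤ H (z + ⌊x - y⌋) :=
    hH.runInf_le (by linarith [Int.lt_floor_add_one (x - y)])
  have hsup : H (y + ⌊x - y⌋) ≤ runSup H x := hH.le_runSup (by linarith [Int.floor_le (x - y)])
  rw [hH.map_add_int] at hinf hsup
  linarith

/-- The maximum of the sine term at `y` and its minimum at `y + 3/2` differ by at least `5/2`. -/
theorem runInf_arnoldFibre_add_one_le (hα : 5 / 2 * Real.pi ≤ |α|) (x : ℝ) :
    runInf (arnoldFibre τ α) x + 1 ≤ runSup (arnoldFibre τ α) x := by
  obtain ⟨y, hy⟩ := exists_mul_sin_two_pi_mul_eq_abs (α / (2 * Real.pi))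
  have hamp : 5 / 4 ≤ |α / (2 * Real.pi)| := by
    rw [abs_div, abs_of_pos Real.two_pi_pos, le_div_iff₀ Real.two_pi_pos]
    linarith
  have hH := isDegOneLift_arnoldFibre τ α
  refine hH.runInf_add_le_runSup (y := y) (z := y + 1 / 2 + 1) (by linarith) ?_ x
  rw [hH.map_add_one, arnoldFibre, arnoldFibre, sin_two_pi_mul_add_half, mul_neg, hy]
  linarith

end ArnoldFibre

theorem exists_eq_skew_of_isLift_arnold {ω τ α β : ℝ} {F : Circ × ℝ → Circ × ℝ}
    (hF : IsLift (arnold ω τ α β) F) :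
    ∃ k : ℤ, F = skew ω (fun θ => β * sinCirc θ) (arnoldFibre (τ + k) α) := by
  obtain ⟨k, hk⟩ := exists_int_add_eq_of_isLift hF (isLift_arnoldLift ω τ α β)
  refine ⟨k, funext fun z => (hk z).trans (Prod.ext rfl ?_)⟩
  simp only [arnoldLift, skew, arnoldFibre]
  ring

section ArnoldLift

variable {ω τ α β : ℝ} {F : Circ × ℝ → Circ × ℝ}

theorem denseRange_nsmul_coe (hω : Irrational ω) : DenseRange fun n : ℕ => n • (ω : Circ) :=
  denseRange_zsmul_iff_nsmul.1 (AddCircle.denseRange_zsmul_coe_iff.2 (by rwa [div_one]))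

theorem exists_isStrangelyDispersed_arnold (hω : Irrational ω) (hF : IsLift (arnold ω τ α β) F)
    (hα : 1 < |α|) (hβ : 1 ≤ |β|) {ρ : ℝ} (hρ : ρ ∈ fibRot F) :
    ∃ M, IsStrangelyDispersed (arnold ω τ α β) M ∧ HasUniformRotation F M ρ ∧
      ZeroEntropyOn (arnold ω τ α β) M := by
  obtain ⟨k, rfl⟩ := exists_eq_skew_of_isLift_arnold hF
  exact (isDegOneLift_arnoldFibre (τ + k) α).exists_isStrangelyDispersed
    (not_monotone_arnoldFibre (τ + k) hα) (continuous_const.mul continuous_sinCirc)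
    (exists_mul_sinCirc_add_two_le hβ) (denseRange_nsmul_coe hω) hF hρ

theorem exists_fibRot_eq_Icc_of_isLift_arnold (hω : Irrational ω) (hF : IsLift (arnold ω τ α β) F)
    (hα : 5 / 2 * Real.pi ≤ |α|) : ∃ ρ₁ ρ₂ : ℝ, fibRot F = Icc ρ₁ ρ₂ ∧ 1 ≤ ρ₂ - ρ₁ := by
  obtain ⟨k, rfl⟩ := exists_eq_skew_of_isLift_arnold hF
  have hH := isDegOneLift_arnoldFibre (τ + k) α
  have hb : Continuous fun θ => β * sinCirc θ := continuous_const.mul continuous_sinCirc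
  have hlength := fibRotNum_add_one_le hH.isMonoLift_runInf hH.isMonoLift_runSup
    (runInf_arnoldFibre_add_one_le (τ + k) hα) hb (denseRange_nsmul_coe hω)
  exact ⟨_, _, hH.fibRot_skew_eq_Icc hb (denseRange_nsmul_coe hω), by linarith⟩

end ArnoldLift

end

end QuasiperiodicForcing

theorem theoremt_general (ω τ α β : ℝ) (hω : Irrational ω)
    (F : QPF.Circ × ℝ → QPF.Circ × ℝ) (hF : QPF.IsLift (QPF.arnold ω τ α β) F) :
    (1 < |α| → 1 ≤ |β| → ∀ ρ ∈ QPF.fibRot F, ∃ M : Set (QPF.Circ × QPF.Circ),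
      QPF.IsStrangelyDispersed (QPF.arnold ω τ α β) M ∧
      QPF.HasUniformRotation F M ρ ∧
      QPF.ZeroEntropyOn (QPF.arnold ω τ α β) M) ∧
    (5 / 2 * Real.pi ≤ |α| →
      (∃ ρ₁ ρ₂ : ℝ, QPF.fibRot F = Set.Icc ρ₁ ρ₂ ∧ 1 ≤ ρ₂ - ρ₁) ∧
      (interior (QPF.fibRot F)).Nonempty) ∧
    (1 ≤ |β| → 5 / 2 * Real.pi ≤ |α| →
      ∃ M : ℝ → Set (QPF.Circ × QPF.Circ),
        (∀ ρ ∈ QPF.fibRot F,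
          QPF.IsStrangelyDispersed (QPF.arnold ω τ α β) (M ρ) ∧
          QPF.HasUniformRotation F (M ρ) ρ ∧
          QPF.ZeroEntropyOn (QPF.arnold ω τ α β) (M ρ)) ∧
        (QPF.fibRot F).PairwiseDisjoint M ∧
        ¬ (M '' QPF.fibRot F).Countable) := by
  have hexists (hα : 1 < |α|) (hβ : 1 ≤ |β|) (ρ : ℝ) (hρ : ρ ∈ QPF.fibRot F) :=
    QuasiperiodicForcing.exists_isStrangelyDispersed_arnold hω hF hα hβ hρ
  have hIcc (hα : 5 / 2 * Real.pi ≤ |α|) :=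
    QuasiperiodicForcing.exists_fibRot_eq_Icc_of_isLift_arnold hω hF hα
  refine ⟨hexists, fun hα => ⟨hIcc hα, ?_⟩, fun hβ hα => ?_⟩
  · obtain ⟨ρ₁, ρ₂, hI, hlength⟩ := hIcc hα
    rw [hI, interior_Icc, nonempty_Ioo]
    linarith
  · obtain ⟨ρ₁, ρ₂, hI, hlength⟩ := hIcc hα
    choose! M hM using hexists (by linarith [Real.pi_gt_three]) hβ
    have hdisj : (QPF.fibRot F).PairwiseDisjoint M := fun ρ hρ ρ' hρ' hne =>
      QuasiperiodicForcing.disjoint_of_hasUniformRotation (hM ρ hρ).2.1 (hM ρ' hρ').2.1 hne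
    have huncountable : ¬ (QPF.fibRot F).Countable := by
      rw [hI, Cardinal.Real.Icc_countable_iff]
      linarith
    exact ⟨M, hM, hdisj, QuasiperiodicForcing.not_countable_image_of_pairwiseDisjoint
      huncountable hdisj fun ρ hρ => (hM ρ hρ).1.minimal.nonempty⟩

theorem theoremt (ω τ α β : ℝ) (hω : Irrational ω)
    (F : QPF.Circ × ℝ → QPF.Circ × ℝ) (hF : QPF.IsLift (QPF.arnold ω τ α β) F) :
    (1 < α → 3 / 2 ≤ |β| → ∀ ρ ∈ QPF.fibRot F, ∃ M : Set (QPF.Circ × QPF.Circ),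
      QPF.IsStrangelyDispersed (QPF.arnold ω τ α β) M ∧
      QPF.HasUniformRotation F M ρ ∧
      QPF.ZeroEntropyOn (QPF.arnold ω τ α β) M) ∧
    (5 / 2 * Real.pi ≤ |α| →
      (∃ ρ₁ ρ₂ : ℝ, QPF.fibRot F = Set.Icc ρ₁ ρ₂ ∧ 1 ≤ ρ₂ - ρ₁) ∧
      (interior (QPF.fibRot F)).Nonempty) ∧
    (1 < α → 3 / 2 ≤ |β| → 5 / 2 * Real.pi ≤ |α| →
      ∃ M : ℝ → Set (QPF.Circ × QPF.Circ),
        (∀ ρ ∈ QPF.fibRot F,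
          QPF.IsStrangelyDispersed (QPF.arnold ω τ α β) (M ρ) ∧
          QPF.HasUniformRotation F (M ρ) ρ ∧
          QPF.ZeroEntropyOn (QPF.arnold ω τ α β) (M ρ)) ∧
        (QPF.fibRot F).PairwiseDisjoint M ∧
        ¬ (M '' QPF.fibRot F).Countable) := by
  obtain ⟨hexists, hinterval, hfamily⟩ := theoremt_general ω τ α β hω F hF
  exact ⟨fun hα hβ => hexists (hα.trans_le (le_abs_self α)) (by linarith), hinterval,
    fun _ hβ => hfamily (by linarith)⟩
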